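/- Let $\mathscr H$ be the complex Hilbert space of functions $u$ on $[0,\infty)$ that are absolutely continuous on every interval $[0,R]$, vanish at $0$ and satisfy $\int_0^\infty\bigl(|u'|^2+\tfrac{2}{r^2}|u|^2\bigr)\,dr<\infty$, with scalar product $$\langle u,v\rangle=\int_0^\infty\Bigl(\overline{u'}\,v'+\frac{2}{r^2}\,\overline{u}\,v\Bigr)dr .$$ Let $T=-\frac{d^2}{dr^2}+\frac{2}{r^2}$ and $D=\frac{d}{dr}-\frac1r$, and let $\tilde T=T|_{\mathcal W_0}$, where $\mathcal W_0$ is the space of functions $u$, smooth on $[0,\infty)$, such that $u\in\mathscr H$, $Tu\in\mathscr H$ and $u''(0)=0$. Then: 1. $\tilde T$ is a symmetric operator in $\mathscr H$: it is densely defined and $\langle \tilde Tu,v\rangle=\langle u,\tilde Tv\rangle$ for all $u,v\in\mathcal W_0$. 2. $\tilde T$ has deficiency indices $(1,1)$, that is, $\dim\ker(\tilde T^*-i)=\dim\ker(\tilde T^*+i)=1$. 3. For every $\rho>0$ the functions $$c_\pm(r)=D\exp\{e^{\mp 3\pi i/4}\rho r\}+\frac1r$$ are nonzero elements of $\mathscr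 H$, and $\ker(\tilde T^*+i\rho^2)=\mathbb C\,c_+$, $\ker(\tilde T^*-i\rho^2)=\mathbb C\,c_-$. 4. Consequently, $\tilde T$ has non-trivial self-adjoint extensions: there are at least two different self-adjoint operators in $\mathscr H$ that extend $\tilde T$. -/

import Mathlib

open MeasureTheory Set Filter
open scoped ComplexConjugate ContDiff Topology InnerProductSpace LinearPMap

noncomputable section

/-! ### The energy space on the half-line -/

/-- Lebesgue measure on the half-line `(0, ∞)`. -/
abbrev halfLine : Measure ℝ := volume.restrict (Ioi (0 : ℝ))

/-- Functions on the half-line that are absolutely continuous on every `[0, R]`, vanish at `0`, and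
have `∫₀^∞ (|u'|² + 2 |u|² / r²) dr < ∞`. A function on the half-line is represented by its
extension by zero to the negative axis. -/
structure IsFiniteEnergy (u : ℝ → ℂ) : Prop where
  eq_zero : ∀ r ≤ 0, u r = 0
  ac : ∀ R : ℝ, 0 < R → AbsolutelyContinuousOnInterval u 0 R
  memLp_deriv : MemLp (deriv u) 2 halfLine
  memLp_div : MemLp (fun r : ℝ => u r / (r : ℂ)) 2 halfLine

namespace IsFiniteEnergy

lemma ae_differentiableAt {u : ℝ → ℂ} (hu : ∀ R : ℝ, 0 < R → AbsolutelyContinuousOnInterval u 0 R) :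
    ∀ᵐ r ∂halfLine, DifferentiableAt ℝ u r := by
  rw [ae_restrict_iff' measurableSet_Ioi]
  have h : ∀ n : ℕ, ∀ᵐ r : ℝ, r ∈ uIcc (0 : ℝ) (n + 1) → DifferentiableAt ℝ u r := fun n =>
    (hu (n + 1) (by positivity)).boundedVariationOn.ae_differentiableAt_of_mem_uIcc
  filter_upwards [ae_all_iff.2 h] with r hr hr0
  obtain ⟨n, hn⟩ := exists_nat_ge r
  refine hr n ?_
  rw [uIcc_of_le (by positivity)]
  exact ⟨le_of_lt hr0, by linarith⟩

lemma intervalIntegrable_of_memLp {g : ℝ → ℂ} (hg : MemLp g 2 halfLine) {R : ℝ} (hR : 0 ≤ R) :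
    IntervalIntegrable g volume 0 R := by
  rw [intervalIntegrable_iff, uIoc_of_le hR]
  have h1 : MemLp g 2 (volume.restrict (Ioc 0 R)) :=
    hg.mono_measure (Measure.restrict_mono Ioc_subset_Ioi_self le_rfl)
  exact h1.integrable (by norm_num)

lemma ac_integral {g : ℝ → ℂ} {R : ℝ} (hg : IntervalIntegrable g volume 0 R) :
    AbsolutelyContinuousOnInterval (fun x => ∫ t in (0 : ℝ)..x, g t) 0 R := by
  have hre : IntervalIntegrable (fun t => (g t).re) volume 0 R := ⟨hg.1.re, hg.2.re⟩
  have him : IntervalIntegrable (fun t => (g t).im) volume 0 R := ⟨hg.1.im, hg.2.im⟩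
  have h1 := hre.absolutelyContinuousOnInterval_intervalIntegral (c := 0) left_mem_uIcc
  have h2 := him.absolutelyContinuousOnInterval_intervalIntegral (c := 0) left_mem_uIcc
  rw [absolutelyContinuousOnInterval_iff] at h1 h2 ⊢
  intro ε hε
  obtain ⟨δ1, hδ1, H1⟩ := h1 (ε / 2) (by positivity)
  obtain ⟨δ2, hδ2, H2⟩ := h2 (ε / 2) (by positivity)
  refine ⟨min δ1 δ2, lt_min hδ1 hδ2, fun E hE hEd => ?_⟩
  have k1 := H1 E hE (lt_of_lt_of_le hEd (min_le_left _ _))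
  have k2 := H2 E hE (lt_of_lt_of_le hEd (min_le_right _ _))
  refine lt_of_le_of_lt ?_ ((add_lt_add k1 k2).trans_eq (add_halves ε))
  rw [← Finset.sum_add_distrib]
  refine Finset.sum_le_sum fun i hi => ?_
  have key : ∀ x ∈ uIcc 0 R, IntervalIntegrable g volume 0 x := fun x hx =>
    hg.mono_set (uIcc_subset_uIcc left_mem_uIcc hx)
  have hr : ∀ x ∈ uIcc 0 R, (∫ t in (0 : ℝ)..x, g t).re = ∫ t in (0 : ℝ)..x, (g t).re :=
    fun x hx => (Complex.reCLM.intervalIntegral_comp_comm (key x hx)).symm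
  have hm : ∀ x ∈ uIcc 0 R, (∫ t in (0 : ℝ)..x, g t).im = ∫ t in (0 : ℝ)..x, (g t).im :=
    fun x hx => (Complex.imCLM.intervalIntegral_comp_comm (key x hx)).symm
  have hmem := hE.1 i hi
  rw [← hr _ hmem.1, ← hr _ hmem.2, ← hm _ hmem.1, ← hm _ hmem.2, Complex.dist_eq, Real.dist_eq,
    Real.dist_eq, ← Complex.sub_re, ← Complex.sub_im]
  exact Complex.norm_le_abs_re_add_abs_im _

/-- The fundamental theorem of calculus. -/
lemma eq_integral {u : ℝ → ℂ} (hu : IsFiniteEnergy u) {R : ℝ} (hR : 0 < R) :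
    u R = ∫ t in (0 : ℝ)..R, deriv u t := by
  have hi := intervalIntegrable_of_memLp hu.memLp_deriv hR.le
  have hac := (hu.ac R hR).sub (ac_integral hi)
  have hd := ae_differentiableAt hu.ac
  rw [ae_restrict_iff' measurableSet_Ioi] at hd
  have h0 : ∀ᵐ x : ℝ, x ≠ 0 := by simp [ae_iff, measure_singleton]
  obtain ⟨C, hC⟩ := hac.const_of_ae_hasDerivAt_zero (by
    filter_upwards [hd, hi.ae_hasDerivAt_integral, h0] with x h1 h2 h3 hx
    have hx' : 0 < x := by
      rw [uIcc_of_le hR.le] at hx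
      exact lt_of_le_of_ne hx.1 (Ne.symm h3)
    have := (h1 hx').hasDerivAt.sub (h2 hx 0 left_mem_uIcc)
    simpa using this)
  have e0 := hC 0 left_mem_uIcc
  have e1 := hC R right_mem_uIcc
  simp only [Pi.sub_apply, intervalIntegral.integral_same, hu.eq_zero 0 le_rfl, sub_zero] at e0 e1
  rw [← e0] at e1
  exact sub_eq_zero.1 e1

lemma deriv_add_ae {u v : ℝ → ℂ} (hu : IsFiniteEnergy u) (hv : IsFiniteEnergy v) :
    deriv (u + v) =ᵐ[halfLine] deriv u + deriv v := by
  filter_upwards [ae_differentiableAt hu.ac, ae_differentiableAt hv.ac] with r h1 h2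
  exact deriv_add h1 h2

lemma deriv_smul_eq (a : ℂ) (u : ℝ → ℂ) : deriv (a • u) = a • deriv u := by
  funext r
  exact deriv_const_smul_field a u

lemma zero : IsFiniteEnergy (0 : ℝ → ℂ) where
  eq_zero _ _ := rfl
  ac R _ := by
    have : ContDiffOn ℝ 1 (0 : ℝ → ℂ) (uIcc 0 R) := contDiffOn_const (c := (0 : ℂ))
    exact this.absolutelyContinuousOnInterval
  memLp_deriv := by
    have : deriv (0 : ℝ → ℂ) = 0 := by funext r; exact deriv_const r (0 : ℂ)
    rw [this]
    exact MemLp.zero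
  memLp_div := by simp

lemma add {u v : ℝ → ℂ} (hu : IsFiniteEnergy u) (hv : IsFiniteEnergy v) :
    IsFiniteEnergy (u + v) where
  eq_zero r hr := by simp [hu.eq_zero r hr, hv.eq_zero r hr]
  ac R hR := (hu.ac R hR).add (hv.ac R hR)
  memLp_deriv := (memLp_congr_ae (deriv_add_ae hu hv)).2 (hu.memLp_deriv.add hv.memLp_deriv)
  memLp_div := by
    have := hu.memLp_div.add hv.memLp_div
    refine (memLp_congr_ae (Eventually.of_forall fun r => ?_)).2 this
    simp [add_div]

lemma smul (a : ℂ) {u : ℝ → ℂ} (hu : IsFiniteEnergy u) : IsFiniteEnergy (a • u) where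
  eq_zero r hr := by simp [hu.eq_zero r hr]
  ac R hR := (hu.ac R hR).const_smul a
  memLp_deriv := by
    rw [deriv_smul_eq]
    exact hu.memLp_deriv.const_smul a
  memLp_div := by
    have := hu.memLp_div.const_smul a
    refine (memLp_congr_ae (Eventually.of_forall fun r => ?_)).2 this
    simp [mul_div_assoc]

end IsFiniteEnergy

/-- The functions of finite energy, as a complex vector space. -/
def energySubmodule : Submodule ℂ (ℝ → ℂ) where
  carrier := {u | IsFiniteEnergy u}
  zero_mem' := IsFiniteEnergy.zero
  add_mem' hu hv := IsFiniteEnergy.add hu hv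
  smul_mem' a _ hu := IsFiniteEnergy.smul a hu

/-- The Hilbert space generated by the scalar product `∫₀^∞ (ū' v' + 2 ū v / r²) dr`. -/
def EnergySpace : Type := energySubmodule

namespace EnergySpace

instance : AddCommGroup EnergySpace := inferInstanceAs (AddCommGroup energySubmodule)

instance : Module ℂ EnergySpace := inferInstanceAs (Module ℂ energySubmodule)

/-- The underlying function. -/
def fn (u : EnergySpace) : ℝ → ℂ := u.1

/-- The element of the space given by a function of finite energy. -/
def mk (f : ℝ → ℂ) (hf : IsFiniteEnergy f) : EnergySpace := ⟨f, hf⟩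

lemma prop (u : EnergySpace) : IsFiniteEnergy u.fn := u.2

@[simp] lemma fn_mk (f : ℝ → ℂ) (hf : IsFiniteEnergy f) : (mk f hf).fn = f := rfl

@[simp] lemma fn_zero : (0 : EnergySpace).fn = 0 := rfl

@[simp] lemma fn_add (u v : EnergySpace) : (u + v).fn = u.fn + v.fn := rfl

@[simp] lemma fn_smul (a : ℂ) (u : EnergySpace) : (a • u).fn = a • u.fn := rfl

lemma fn_injective : Function.Injective fn := fun _ _ h => Subtype.ext h

/-- The scalar product `⟨u, v⟩ = ∫₀^∞ (ū' v' + 2 ū v / r²) dr`. -/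
def energyInner (u v : EnergySpace) : ℂ :=
  ∫ r in Ioi (0 : ℝ),
    (conj (deriv u.fn r) * deriv v.fn r + 2 / (r : ℂ) ^ 2 * (conj (u.fn r) * v.fn r))

/-- The derivative as an element of `L²`. -/
def derivLp (u : EnergySpace) : Lp ℂ 2 halfLine := u.prop.memLp_deriv.toLp _

/-- The quotient `u / r` as an element of `L²`. -/
def divLp (u : EnergySpace) : Lp ℂ 2 halfLine := u.prop.memLp_div.toLp _

lemma derivLp_add (u v : EnergySpace) : derivLp (u + v) = derivLp u + derivLp v := by
  rw [derivLp, derivLp, derivLp, ← MemLp.toLp_add]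
  exact MemLp.toLp_congr _ _ (IsFiniteEnergy.deriv_add_ae u.prop v.prop)

lemma divLp_add (u v : EnergySpace) : divLp (u + v) = divLp u + divLp v := by
  rw [divLp, divLp, divLp, ← MemLp.toLp_add]
  exact MemLp.toLp_congr _ _ (Eventually.of_forall fun r => by simp [add_div])

lemma derivLp_smul (a : ℂ) (u : EnergySpace) : derivLp (a • u) = a • derivLp u := by
  rw [derivLp, derivLp, ← MemLp.toLp_const_smul]
  exact MemLp.toLp_congr _ _ (Eventually.of_forall fun r => by
    simp [IsFiniteEnergy.deriv_smul_eq])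

lemma divLp_smul (a : ℂ) (u : EnergySpace) : divLp (a • u) = a • divLp u := by
  rw [divLp, divLp, ← MemLp.toLp_const_smul]
  exact MemLp.toLp_congr _ _ (Eventually.of_forall fun r => by simp [mul_div_assoc])

lemma energyInner_eq (u v : EnergySpace) :
    energyInner u v = ⟪derivLp u, derivLp v⟫_ℂ + 2 * ⟪divLp u, divLp v⟫_ℂ := by
  have i1 := L2.integrable_inner (𝕜 := ℂ) (derivLp u) (derivLp v)
  have i2 := L2.integrable_inner (𝕜 := ℂ) (divLp u) (divLp v)
  rw [L2.inner_def, L2.inner_def, ← integral_const_mul, ← integral_add i1 (i2.const_mul 2)]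
  refine integral_congr_ae ?_
  filter_upwards [u.prop.memLp_deriv.coeFn_toLp, v.prop.memLp_deriv.coeFn_toLp,
    u.prop.memLp_div.coeFn_toLp, v.prop.memLp_div.coeFn_toLp] with r h1 h2 h3 h4
  simp only [derivLp, divLp, h1, h2, h3, h4, RCLike.inner_apply, map_div₀, Complex.conj_ofReal]
  ring

/-- The scalar product makes the functions of finite energy a pre-Hilbert space. -/
@[reducible]
def core : InnerProductSpace.Core ℂ EnergySpace where
  inner := energyInner
  conj_inner_symm u v := by
    simp only [energyInner_eq, map_add, map_mul, inner_conj_symm, Complex.conj_ofNat]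
  re_inner_nonneg u := by
    have h1 := inner_self_nonneg (𝕜 := ℂ) (x := derivLp u)
    have h2 := inner_self_nonneg (𝕜 := ℂ) (x := divLp u)
    simp only [energyInner_eq, RCLike.re_to_complex, Complex.add_re, Complex.mul_re,
      Complex.re_ofNat, Complex.im_ofNat, zero_mul, sub_zero] at h1 h2 ⊢
    linarith
  add_left u v w := by
    simp only [energyInner_eq, derivLp_add, divLp_add, inner_add_left]
    ring
  smul_left u v a := by
    simp only [energyInner_eq, derivLp_smul, divLp_smul, inner_smul_left]
    ring
  definite u hu := by
    have h1 := inner_self_nonneg (𝕜 := ℂ) (x := derivLp u)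
    have h2 := inner_self_nonneg (𝕜 := ℂ) (x := divLp u)
    have h3 := congrArg Complex.re hu
    simp only [energyInner_eq, RCLike.re_to_complex, Complex.add_re, Complex.mul_re,
      Complex.re_ofNat, Complex.im_ofNat, zero_mul, sub_zero, Complex.zero_re] at h1 h2 h3
    have h4 : RCLike.re ⟪derivLp u, derivLp u⟫_ℂ = 0 := by
      rw [RCLike.re_to_complex]; linarith
    rw [inner_self_eq_norm_sq, sq_eq_zero_iff, norm_eq_zero] at h4
    have h5 : deriv u.fn =ᵐ[halfLine] 0 := by
      have := u.prop.memLp_deriv.coeFn_toLp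
      filter_upwards [this, Lp.coeFn_zero ℂ 2 halfLine] with r hr hr0
      rw [← hr, show u.prop.memLp_deriv.toLp _ = (0 : Lp ℂ 2 halfLine) from h4, hr0]
    refine fn_injective (funext fun r => ?_)
    rcases le_or_gt r 0 with hr | hr
    · rw [u.prop.eq_zero r hr]; rfl
    · rw [u.prop.eq_integral hr, intervalIntegral.integral_of_le hr.le]
      have h6 : deriv u.fn =ᵐ[volume.restrict (Ioc 0 r)] 0 :=
        ae_restrict_of_ae_restrict_of_subset Ioc_subset_Ioi_self h5
      rw [integral_congr_ae h6]
      simp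

instance : NormedAddCommGroup EnergySpace :=
  @InnerProductSpace.Core.toNormedAddCommGroup ℂ EnergySpace _ _ _ core

instance : InnerProductSpace ℂ EnergySpace := InnerProductSpace.ofCore core.toCore

lemma inner_eq (u v : EnergySpace) : ⟪u, v⟫_ℂ = energyInner u v := rfl

lemma norm_sq_eq (u : EnergySpace) : ‖u‖ ^ 2 = ‖derivLp u‖ ^ 2 + 2 * ‖divLp u‖ ^ 2 := by
  rw [← inner_self_eq_norm_sq (𝕜 := ℂ) u, ← inner_self_eq_norm_sq (𝕜 := ℂ) (derivLp u),
    ← inner_self_eq_norm_sq (𝕜 := ℂ) (divLp u), inner_eq, energyInner_eq]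
  simp

lemma derivLp_sub (u v : EnergySpace) : derivLp (u - v) = derivLp u - derivLp v := by
  rw [eq_sub_iff_add_eq, ← derivLp_add, sub_add_cancel]

lemma divLp_sub (u v : EnergySpace) : divLp (u - v) = divLp u - divLp v := by
  rw [eq_sub_iff_add_eq, ← divLp_add, sub_add_cancel]

lemma norm_derivLp_le (u : EnergySpace) : ‖derivLp u‖ ≤ ‖u‖ := by
  refine (pow_le_pow_iff_left₀ (norm_nonneg _) (norm_nonneg _) two_ne_zero).1 ?_
  rw [norm_sq_eq]
  nlinarith [sq_nonneg ‖divLp u‖]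

lemma norm_divLp_le (u : EnergySpace) : ‖divLp u‖ ≤ ‖u‖ := by
  refine (pow_le_pow_iff_left₀ (norm_nonneg _) (norm_nonneg _) two_ne_zero).1 ?_
  rw [norm_sq_eq]
  nlinarith [sq_nonneg ‖divLp u‖, sq_nonneg ‖derivLp u‖]

lemma isFiniteEnergy_primitive (g h : Lp ℂ 2 halfLine)
    (hgh : ∀ᵐ r ∂halfLine, (∫ t in (0 : ℝ)..r, g t) / (r : ℂ) = h r) :
    ∃ u : EnergySpace, derivLp u = g ∧ divLp u = h := by
  set f : ℝ → ℂ := fun r => if 0 < r then ∫ t in (0 : ℝ)..r, g t else 0 with hf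
  have hi : ∀ R : ℝ, 0 ≤ R → IntervalIntegrable g volume 0 R := fun R hR =>
    IsFiniteEnergy.intervalIntegrable_of_memLp (Lp.memLp g) hR
  have hd : deriv f =ᵐ[halfLine] g := by
    rw [EventuallyEq, ae_restrict_iff' measurableSet_Ioi]
    have h1 : ∀ n : ℕ, ∀ᵐ r : ℝ, r ∈ uIcc (0 : ℝ) (n + 1) → ∀ c ∈ uIcc (0 : ℝ) (n + 1),
        HasDerivAt (fun x => ∫ t in c..x, g t) (g r) r := fun n =>
      (hi (n + 1) (by positivity)).ae_hasDerivAt_integral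
    filter_upwards [ae_all_iff.2 h1] with r hr hr0
    obtain ⟨n, hn⟩ := exists_nat_ge r
    have h2 := hr n (by
      rw [uIcc_of_le (by positivity)]
      exact ⟨le_of_lt hr0, by linarith⟩) 0 left_mem_uIcc
    have h3 : f =ᶠ[𝓝 r] fun x => ∫ t in (0 : ℝ)..x, g t := by
      filter_upwards [Ioi_mem_nhds hr0] with x hx
      simp only [hf, if_pos (show 0 < x from hx)]
    exact (h2.congr_of_eventuallyEq h3).deriv
  have hq : (fun r : ℝ => f r / (r : ℂ)) =ᵐ[halfLine] h := by
    filter_upwards [hgh, ae_restrict_mem measurableSet_Ioi] with r h1 h2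
    simp only [hf, if_pos (show 0 < r from h2), h1]
  have hfe : IsFiniteEnergy f :=
    { eq_zero := fun r hr => by simp [hf, not_lt.2 hr]
      ac := fun R hR => by
        have h1 := IsFiniteEnergy.ac_integral (hi R hR.le)
        rw [absolutelyContinuousOnInterval_iff] at h1 ⊢
        intro ε hε
        obtain ⟨δ, hδ, H⟩ := h1 ε hε
        refine ⟨δ, hδ, fun E hE hEd => ?_⟩
        have h2 : ∀ x ∈ uIcc 0 R, f x = ∫ t in (0 : ℝ)..x, g t := by
          intro x hx
          rw [uIcc_of_le hR.le] at hx
          rcases hx.1.eq_or_lt with h | h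
          · simp [hf, ← h]
          · simp only [hf, if_pos h]
        refine lt_of_eq_of_lt (Finset.sum_congr rfl fun i hi => ?_) (H E hE hEd)
        rw [h2 _ (hE.1 i hi).1, h2 _ (hE.1 i hi).2]
      memLp_deriv := (memLp_congr_ae hd).2 (Lp.memLp g)
      memLp_div := (memLp_congr_ae hq).2 (Lp.memLp h) }
  refine ⟨mk f hfe, Lp.ext ?_, Lp.ext ?_⟩
  · exact (hfe.memLp_deriv.coeFn_toLp).trans hd
  · exact (hfe.memLp_div.coeFn_toLp).trans hq

instance : CompleteSpace EnergySpace := by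
  refine Metric.complete_of_cauchySeq_tendsto fun u hu => ?_
  have hc1 : CauchySeq fun n => derivLp (u n) := by
    rw [Metric.cauchySeq_iff] at hu ⊢
    intro ε hε
    obtain ⟨N, hN⟩ := hu ε hε
    refine ⟨N, fun m hm n hn => lt_of_le_of_lt ?_ (hN m hm n hn)⟩
    rw [dist_eq_norm, dist_eq_norm, ← derivLp_sub]
    exact norm_derivLp_le _
  have hc2 : CauchySeq fun n => divLp (u n) := by
    rw [Metric.cauchySeq_iff] at hu ⊢
    intro ε hε
    obtain ⟨N, hN⟩ := hu ε hε
    refine ⟨N, fun m hm n hn => lt_of_le_of_lt ?_ (hN m hm n hn)⟩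
    rw [dist_eq_norm, dist_eq_norm, ← divLp_sub]
    exact norm_divLp_le _
  obtain ⟨g, hg⟩ := cauchySeq_tendsto_of_complete hc1
  obtain ⟨h, hh⟩ := cauchySeq_tendsto_of_complete hc2
  have hpt : ∀ r : ℝ, 0 < r → Tendsto (fun n => (u n).fn r) atTop (𝓝 (∫ t in (0 : ℝ)..r, g t)) := by
    intro r hr
    have hfin : halfLine (Ioc 0 r) ≠ ⊤ :=
      ((Measure.restrict_apply_le _ _).trans_lt (by simp)).ne
    have hrest : halfLine.restrict (Ioc 0 r) = volume.restrict (Ioc 0 r) := by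
      rw [halfLine, Measure.restrict_restrict measurableSet_Ioc,
        inter_eq_left.2 Ioc_subset_Ioi_self]
    have key : ∀ f : Lp ℂ 2 halfLine,
        ⟪indicatorConstLp 2 measurableSet_Ioc hfin (1 : ℂ), f⟫_ℂ = ∫ t in (0 : ℝ)..r, f t := by
      intro f
      rw [L2.inner_indicatorConstLp_one, intervalIntegral.integral_of_le hr.le, hrest]
    have h1 : Tendsto (fun n => ⟪indicatorConstLp 2 measurableSet_Ioc hfin (1 : ℂ),
        derivLp (u n)⟫_ℂ) atTop (𝓝 ⟪indicatorConstLp 2 measurableSet_Ioc hfin (1 : ℂ), g⟫_ℂ) :=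
      tendsto_const_nhds.inner hg
    rw [key] at h1
    refine h1.congr fun n => ?_
    rw [key, (u n).prop.eq_integral hr, intervalIntegral.integral_of_le hr.le,
      intervalIntegral.integral_of_le hr.le]
    refine integral_congr_ae ?_
    exact ae_restrict_of_ae_restrict_of_subset Ioc_subset_Ioi_self
      (u n).prop.memLp_deriv.coeFn_toLp
  obtain ⟨φ, hφ, hae⟩ := (tendstoInMeasure_of_tendsto_Lp hh).exists_seq_tendsto_ae
  have hquot : ∀ᵐ r ∂halfLine, (∫ t in (0 : ℝ)..r, g t) / (r : ℂ) = h r := by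
    have hall : ∀ᵐ r ∂halfLine, ∀ n, divLp (u n) r = (u n).fn r / (r : ℂ) :=
      ae_all_iff.2 fun n => (u n).prop.memLp_div.coeFn_toLp
    filter_upwards [hae, hall, ae_restrict_mem measurableSet_Ioi] with r h1 h2 h3
    refine tendsto_nhds_unique ?_ h1
    simp only [h2]
    exact ((hpt r h3).comp hφ.tendsto_atTop).div_const _
  obtain ⟨v, hv1, hv2⟩ := isFiniteEnergy_primitive g h hquot
  refine ⟨v, ?_⟩
  rw [tendsto_iff_norm_sub_tendsto_zero] at hg hh ⊢
  have h1 : Tendsto (fun n => ‖u n - v‖ ^ 2) atTop (𝓝 0) := by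
    have := (hg.pow 2).add ((hh.pow 2).const_mul 2)
    simp only [ne_eq, OfNat.ofNat_ne_zero, not_false_eq_true, zero_pow, mul_zero, add_zero] at this
    refine this.congr fun n => ?_
    rw [norm_sq_eq, derivLp_sub, divLp_sub, hv1, hv2]
  have h2 := h1.sqrt
  simpa [Real.sqrt_sq (norm_nonneg _)] using h2

end EnergySpace

/-! ### The differential operations -/

/-- `T u = -u'' + (2 / r²) u` on `(0, ∞)`, extended by zero. -/
def radialT (u : ℝ → ℂ) (r : ℝ) : ℂ :=
  if 0 < r then -iteratedDeriv 2 u r + 2 / (r : ℂ) ^ 2 * u r else 0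

/-- `D u = u' - u / r`. -/
def radialD (u : ℝ → ℂ) (r : ℝ) : ℂ := deriv u r - u r / (r : ℂ)

lemma two_le_smooth : (2 : WithTop ℕ∞) ≤ ∞ := by
  exact WithTop.coe_le_coe.2 (le_top : (2 : ℕ∞) ≤ ⊤)

lemma radialT_add {u v : ℝ → ℂ} (hu : ContDiffOn ℝ ∞ u (Ici 0)) (hv : ContDiffOn ℝ ∞ v (Ici 0)) :
    radialT (u + v) = radialT u + radialT v := by
  funext r
  by_cases hr : 0 < r
  · have h1 : ContDiffAt ℝ 2 u r := (hu.contDiffAt (Ici_mem_nhds hr)).of_le two_le_smooth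
    have h2 : ContDiffAt ℝ 2 v r := (hv.contDiffAt (Ici_mem_nhds hr)).of_le two_le_smooth
    simp only [radialT, if_pos hr, Pi.add_apply, iteratedDeriv_add h1 h2]
    ring
  · simp [radialT, hr]

lemma radialT_smul (a : ℂ) (u : ℝ → ℂ) : radialT (a • u) = a • radialT u := by
  funext r
  by_cases hr : 0 < r
  · have h2 : iteratedDeriv 2 (a • u) r = a • iteratedDeriv 2 u r :=
      iteratedDeriv_const_smul_field a u
    simp only [radialT, if_pos hr, Pi.smul_apply, h2, smul_eq_mul]
    ring
  · simp [radialT, hr]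

lemma radialT_zero : radialT 0 = 0 := by
  have h := radialT_smul 0 0
  rwa [zero_smul, zero_smul] at h

/-- The functions `u`, smooth on `[0, ∞)`, with `u` and `T u` of finite energy and `u''(0) = 0`
(a one-sided derivative). -/
def domainW0 : Submodule ℂ EnergySpace where
  carrier := {u | ContDiffOn ℝ ∞ u.fn (Ici 0) ∧ IsFiniteEnergy (radialT u.fn) ∧
    iteratedDerivWithin 2 u.fn (Ici 0) 0 = 0}
  zero_mem' := by
    refine ⟨contDiffOn_const, ?_, ?_⟩
    · rw [EnergySpace.fn_zero, radialT_zero]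
      exact IsFiniteEnergy.zero
    · have h := iteratedDerivWithin_const_smul_field (n := 2) (s := Ici (0 : ℝ)) (x := 0) (0 : ℂ)
        (0 : ℝ → ℂ)
      rwa [zero_smul, zero_smul] at h
  add_mem' := by
    rintro u v ⟨hu1, hu2, hu3⟩ ⟨hv1, hv2, hv3⟩
    refine ⟨hu1.add hv1, ?_, ?_⟩
    · rw [EnergySpace.fn_add, radialT_add hu1 hv1]
      exact hu2.add hv2
    · have m0 : (0 : ℝ) ∈ Ici (0 : ℝ) := mem_Ici.2 le_rfl
      rw [EnergySpace.fn_add, iteratedDerivWithin_add m0 (uniqueDiffOn_Ici 0)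
        ((hu1 0 m0).of_le two_le_smooth)
        ((hv1 0 m0).of_le two_le_smooth), hu3, hv3, add_zero]
  smul_mem' := by
    rintro a u ⟨hu1, hu2, hu3⟩
    refine ⟨hu1.const_smul a, ?_, ?_⟩
    · rw [EnergySpace.fn_smul, radialT_smul a u.fn]
      exact hu2.smul a
    · rw [EnergySpace.fn_smul, iteratedDerivWithin_const_smul_field, hu3, smul_zero]

/-- The restriction of `T` to `domainW0`, as an unbounded operator in the energy space. -/
def operatorT0 : EnergySpace →ₗ.[ℂ] EnergySpace where
  domain := domainW0
  toFun :=
    { toFun := fun u => EnergySpace.mk (radialT u.1.fn) u.2.2.1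
      map_add' := fun u v => EnergySpace.fn_injective (radialT_add u.2.1 v.2.1)
      map_smul' := fun a _ => EnergySpace.fn_injective (radialT_smul a _) }

/-! ### Symmetric operators and deficiency indices -/

section Deficiency

variable {E : Type*} [NormedAddCommGroup E] [InnerProductSpace ℂ E]

/-- A symmetric (densely defined) unbounded operator. -/
def IsSymmetricOperator (A : E →ₗ.[ℂ] E) : Prop :=
  Dense (A.domain : Set E) ∧ A.IsFormalAdjoint A

variable [CompleteSpace E]

/-- The kernel of `A† - z`. -/
def deficiencySpace (A : E →ₗ.[ℂ] E) (z : ℂ) : Submodule ℂ E where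
  carrier := {x | ∃ y : A†.domain, (y : E) = x ∧ A† y = z • x}
  zero_mem' := ⟨0, rfl, by simp⟩
  add_mem' := by
    rintro _ _ ⟨y, rfl, hy⟩ ⟨y', rfl, hy'⟩
    exact ⟨y + y', rfl, by rw [LinearPMap.map_add, hy, hy', smul_add]⟩
  smul_mem' := by
    rintro a _ ⟨y, rfl, hy⟩
    exact ⟨a • y, rfl, by rw [LinearPMap.map_smul, hy, smul_comm]⟩

/-- The deficiency indices `(dim ker (A† - i), dim ker (A† + i))`. -/
def deficiencyIndices (A : E →ₗ.[ℂ] E) : Cardinal × Cardinal :=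
  (Module.rank ℂ (deficiencySpace A Complex.I), Module.rank ℂ (deficiencySpace A (-Complex.I)))

end Deficiency

end

/-!
The operator factors as `T = D D*`, where `D* = -(d/dr + 1/r)` satisfies `D* D = -d²/dr²`. Hence
the energy product is `⟨u, v⟩ = (D* u, D* v)` in `L²(0, ∞)` (`EnergySpace.inner_adjD`; in the code
`adjD u = u' + u / r`), and `D*` intertwines `T` with `-d²/dr²`
(`hasDerivAt_deriv_deriv_add_div`). All integrations by parts rest on one remark: if `F'` and
`F / r` are integrable on `(0, ∞)`, then `∫ F' = 0`, because `1 / r` is integrable neither at zero nor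
at infinity (`IsHalfLinePrimitive.integral_eq_zero`). It gives the isometry and Green's formula,
that is, the formal symmetry of the operator (`isFormalAdjoint_operatorT0`).

Test functions `φ` on `(0, ∞)` belong to the domain. The functions `φ' + φ / r` are exactly the
test functions orthogonal to `r`. So, for `w` orthogonal to the domain, `D* w` is a
square-integrable multiple of `r`, hence zero, and the domain is dense
(`dense_operatorT0_domain`). In the same way, if `w` lies in `ker (T† + k²)` with `Re k < 0`, then
the conjugate of `D* w` is orthogonal to every test function `g` orthogonal to `r` and `e^{±κ r}`,
where `κ` is the conjugate of `k`, because for such `g` the equation `-η'' + κ² η = g` is solvable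
by `η = φ' + φ / r` (`testFunctions.exists_solution`). By linear algebra it is a combination of
these three functions, and square integrability leaves only `e^{κ r}`. Therefore `D* w` is a
multiple of `e^{k r}`, and `w` is a multiple of `c = D e^{k r} + 1/r`, for which
`c' + c / r = k² e^{k r}`. Conversely `c` lies in `ker (T† + k²)`; this integration by parts is where the boundary
condition `u''(0) = 0` enters (`integral_exp_mul_eq_zero`, `deficiencySpace_eq_span`).

The self-adjoint extensions come from von Neumann's decomposition of the domain of the adjoint:
modulo the radical of the boundary form `⟨A† x, y⟩ - ⟨x, A† y⟩` this domain is spanned by unit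
vectors `p`, `n` of the two deficiency spaces, the form is diagonal in them with opposite entries,
and each of the null vectors `p + n`, `p - n` defines a self-adjoint boundary condition
(`exists_two_selfAdjoint_extensions`).
-/

/-! ### Self-adjoint extensions of symmetric operators with deficiency indices `(1, 1)` -/

section SelfAdjointExtension

variable {E : Type*} [NormedAddCommGroup E] [InnerProductSpace ℂ E] [CompleteSpace E]

/-- For a densely defined operator, the eigenvalue equation `A† x = z x` in weak form. -/
lemma mem_deficiencySpace_iff {A : E →ₗ.[ℂ] E} (hA : Dense (A.domain : Set E)) {z : ℂ} {x : E} :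
    x ∈ deficiencySpace A z ↔ ∀ u : A.domain, ⟪x, A u⟫_ℂ = conj z * ⟪x, (u : E)⟫_ℂ := by
  constructor
  · rintro ⟨y, rfl, hy⟩ u
    rw [← LinearPMap.adjoint_isFormalAdjoint hA y u, hy, inner_smul_left]
  · intro h
    have hw : ∀ u : A.domain, ⟪z • x, (u : E)⟫_ℂ = ⟪x, A u⟫_ℂ := fun u => by
      rw [inner_smul_left, h]
    exact ⟨⟨x, LinearPMap.mem_adjoint_domain_of_exists x ⟨_, hw⟩⟩, rfl,
      LinearPMap.adjoint_apply_eq hA _ hw⟩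

/-- The boundary form `⟨A† x, y⟩ - ⟨x, A† y⟩` of an operator, on the domain of its adjoint. -/
noncomputable def boundaryForm (A : E →ₗ.[ℂ] E) (x : A†.domain) : A†.domain →ₗ[ℂ] ℂ :=
  (innerₛₗ ℂ (A† x)) ∘ₗ A†.domain.subtype - (innerₛₗ ℂ (x : E)) ∘ₗ A†.toFun

lemma boundaryForm_apply (A : E →ₗ.[ℂ] E) (x y : A†.domain) :
    boundaryForm A x y = ⟪A† x, (y : E)⟫_ℂ - ⟪(x : E), A† y⟫_ℂ := rfl

lemma conj_boundaryForm (A : E →ₗ.[ℂ] E) (x y : A†.domain) :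
    conj (boundaryForm A x y) = -boundaryForm A y x := by
  simp only [boundaryForm_apply, map_sub, inner_conj_symm]
  ring

lemma boundaryForm_eq_zero_symm {A : E →ₗ.[ℂ] E} {x y : A†.domain} (h : boundaryForm A x y = 0) :
    boundaryForm A y x = 0 := by
  have := conj_boundaryForm A x y
  rwa [h, map_zero, eq_comm, neg_eq_zero] at this

lemma boundaryForm_add_left (A : E →ₗ.[ℂ] E) (x x' y : A†.domain) :
    boundaryForm A (x + x') y = boundaryForm A x y + boundaryForm A x' y := by
  simp only [boundaryForm_apply, LinearPMap.map_add, Submodule.coe_add, inner_add_left]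
  ring

lemma boundaryForm_smul_left (A : E →ₗ.[ℂ] E) (a : ℂ) (x y : A†.domain) :
    boundaryForm A (a • x) y = conj a * boundaryForm A x y := by
  simp only [boundaryForm_apply, LinearPMap.map_smul, Submodule.coe_smul, inner_smul_left]
  ring

lemma boundaryForm_of_eigen {A : E →ₗ.[ℂ] E} {x y : A†.domain} {z w : ℂ} (hx : A† x = z • (x : E))
    (hy : A† y = w • (y : E)) :
    boundaryForm A x y = (conj z - w) * ⟪(x : E), (y : E)⟫_ℂ := by
  rw [boundaryForm_apply, hx, hy, inner_smul_left, inner_smul_right]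
  ring

/-- Von Neumann's decomposition of the domain of `A†`: the component outside the two deficiency
spaces lies in the domain of the closure of `A`, so it is invisible to the boundary form. The
decomposition is the orthogonal one of the graph of `A†` along the closure of the graph of `A`. -/
lemma exists_vonNeumann_decomposition {A : E →ₗ.[ℂ] E} (hA : IsSymmetricOperator A)
    (x : A†.domain) :
    ∃ x₀ p n : A†.domain, x = x₀ + p + n ∧ (p : E) ∈ deficiencySpace A Complex.I ∧
      (n : E) ∈ deficiencySpace A (-Complex.I) ∧ ∀ y, boundaryForm A x₀ y = 0 := by
  obtain ⟨hd, hs⟩ := hA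
  have hle : A ≤ A† := hs.le_adjoint hd
  set K : Submodule ℂ (WithLp 2 (E × E)) :=
    (A.graph.map (WithLp.linearEquiv 2 ℂ (E × E)).symm.toLinearMap).topologicalClosure with hK
  have : CompleteSpace K := (Submodule.isClosed_topologicalClosure _).completeSpace_coe
  have hmem : ∀ u : A.domain, WithLp.toLp 2 ((u : E), A u) ∈ K := fun u =>
    Submodule.le_topologicalClosure _ ⟨_, A.mem_graph u, rfl⟩
  obtain ⟨k, hk, m, hm, hkm⟩ :=
    K.exists_add_mem_mem_orthogonal (WithLp.toLp 2 ((x : E), A† x))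
  -- The boundary form against any vector is continuous in the graph norm and vanishes on `A`.
  have hclosed : ∀ q ∈ K, ∀ y : A†.domain, ⟪q.snd, (y : E)⟫_ℂ - ⟪q.fst, A† y⟫_ℂ = 0 := by
    intro q hq y
    have hcl : IsClosed {q : WithLp 2 (E × E) |
        ⟪q.snd, (y : E)⟫_ℂ - ⟪q.fst, A† y⟫_ℂ = 0} := by
      refine isClosed_eq ?_ continuous_const
      fun_prop
    refine closure_minimal ?_ hcl hq
    rintro _ ⟨⟨a, b⟩, hab, rfl⟩
    obtain ⟨u, hu, hu'⟩ := (LinearPMap.mem_graph_iff A).1 hab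
    dsimp only at hu hu'
    subst hu hu'
    have := (LinearPMap.adjoint_isFormalAdjoint hd).symm u y
    simpa [sub_eq_zero] using this
  have hk1 : ∀ u : A.domain, ⟪k.snd, (u : E)⟫_ℂ = ⟪k.fst, A u⟫_ℂ := fun u => by
    have h1 := hclosed k hk ⟨u, hle.1 u.2⟩
    rw [← hle.2 (x := u) rfl] at h1
    exact sub_eq_zero.1 h1
  set x₀ : A†.domain := ⟨k.fst, LinearPMap.mem_adjoint_domain_of_exists _ ⟨_, hk1⟩⟩ with hx₀
  have hAx₀ : A† x₀ = k.snd := LinearPMap.adjoint_apply_eq hd _ hk1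
  have hf : (x : E) = k.fst + m.fst := by
    have := congrArg WithLp.fst hkm
    simpa using this
  have hsn : A† x = k.snd + m.snd := by
    have := congrArg WithLp.snd hkm
    simpa using this
  set m1 : A†.domain := x - x₀ with hm1
  have hm1f : (m1 : E) = m.fst := by simp [hm1, hx₀, hf]
  have hAm1 : A† m1 = m.snd := by rw [hm1, LinearPMap.map_sub, hAx₀, hsn]; abel
  have hm2 : ∀ u : A.domain, ⟪-m.fst, (u : E)⟫_ℂ = ⟪m.snd, A u⟫_ℂ := fun u => by
    have h1 : ⟪m, WithLp.toLp 2 ((u : E), A u)⟫_ℂ = 0 :=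
      Submodule.inner_left_of_mem_orthogonal (hmem u) hm
    rw [WithLp.prod_inner_apply] at h1
    rw [inner_neg_left, neg_eq_iff_add_eq_zero]
    exact h1
  set m2 : A†.domain := ⟨m.snd, LinearPMap.mem_adjoint_domain_of_exists _ ⟨_, hm2⟩⟩ with hm2d
  have hAm2 : A† m2 = -m.fst := LinearPMap.adjoint_apply_eq hd _ hm2
  refine ⟨x₀, (1 / 2 : ℂ) • (m1 - Complex.I • m2), (1 / 2 : ℂ) • (m1 + Complex.I • m2), ?_,
    ⟨_, rfl, ?_⟩, ⟨_, rfl, ?_⟩, ?_⟩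
  · have : x = x₀ + m1 := by rw [hm1]; abel
    rw [add_assoc, ← smul_add, this]
    congr 1
    module
  · simp only [LinearPMap.map_smul, LinearPMap.map_sub, hAm1, hAm2, Submodule.coe_smul,
      Submodule.coe_sub, hm1f]
    rw [show (m2 : E) = m.snd from rfl, smul_comm Complex.I (1 / 2 : ℂ), smul_sub Complex.I,
      smul_smul Complex.I Complex.I, Complex.I_mul_I]
    module
  · simp only [LinearPMap.map_smul, LinearPMap.map_add, hAm1, hAm2, Submodule.coe_smul,
      Submodule.coe_add, hm1f]
    rw [show (m2 : E) = m.snd from rfl, smul_comm (-Complex.I) (1 / 2 : ℂ), smul_add (-Complex.I),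
      smul_smul (-Complex.I) Complex.I, neg_mul, Complex.I_mul_I]
    module
  · intro y
    rw [boundaryForm_apply, hAx₀]
    exact hclosed k hk y

/-- The restriction of `A†` by the boundary condition `boundaryForm A e x = 0`. -/
noncomputable def boundaryRestriction (A : E →ₗ.[ℂ] E) (e : A†.domain) : E →ₗ.[ℂ] E :=
  A†.domRestrict ((LinearMap.ker (boundaryForm A e)).map A†.domain.subtype)

lemma mem_boundaryRestriction_domain {A : E →ₗ.[ℂ] E} {e : A†.domain} {x : E} :
    x ∈ (boundaryRestriction A e).domain ↔
      ∃ y : A†.domain, (y : E) = x ∧ boundaryForm A e y = 0 := by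
  constructor
  · rintro ⟨⟨y, hy, hyx⟩, -⟩
    exact ⟨y, hyx, hy⟩
  · rintro ⟨y, rfl, hy⟩
    exact ⟨⟨y, hy, rfl⟩, y.2⟩

lemma boundaryRestriction_le (A : E →ₗ.[ℂ] E) (e : A†.domain) :
    boundaryRestriction A e ≤ A† := LinearPMap.domRestrict_le

lemma le_boundaryRestriction {A : E →ₗ.[ℂ] E} (hA : IsSymmetricOperator A) (e : A†.domain) :
    A ≤ boundaryRestriction A e := by
  have hle : A ≤ A† := hA.2.le_adjoint hA.1
  have hdom : A.domain ≤ (boundaryRestriction A e).domain := fun u hu => by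
    refine mem_boundaryRestriction_domain.2 ⟨⟨u, hle.1 hu⟩, rfl, ?_⟩
    rw [boundaryForm_apply, ← hle.2 (x := ⟨u, hu⟩) (y := ⟨u, hle.1 hu⟩) rfl, sub_eq_zero]
    exact LinearPMap.adjoint_isFormalAdjoint hA.1 e ⟨u, hu⟩
  refine ⟨hdom, fun u v huv => ?_⟩
  rw [(boundaryRestriction_le A e).2 (x := v) (y := ⟨v, (boundaryRestriction_le A e).1 v.2⟩) rfl]
  exact hle.2 huv

/-- The boundary condition given by a null vector `e` of the boundary form is self-adjoint when,
up to the radical of the form, it is satisfied by the multiples of `e` only. -/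
lemma isSelfAdjoint_boundaryRestriction {A : E →ₗ.[ℂ] E} (hA : IsSymmetricOperator A)
    {e : A†.domain} (he : boundaryForm A e e = 0)
    (hmax : ∀ x, boundaryForm A e x = 0 →
      ∃ (x₀ : A†.domain) (a : ℂ), x = x₀ + a • e ∧ ∀ y, boundaryForm A x₀ y = 0) :
    IsSelfAdjoint (boundaryRestriction A e) := by
  set B := boundaryRestriction A e with hB
  have hAB : A ≤ B := le_boundaryRestriction hA e
  have hBA : B ≤ A† := boundaryRestriction_le A e
  have hBd : Dense (B.domain : Set E) := hA.1.mono hAB.1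
  have hsymm : B.IsFormalAdjoint B := by
    intro u v
    obtain ⟨x, hx, hex⟩ := mem_boundaryRestriction_domain.1 u.2
    obtain ⟨y, hy, hey⟩ := mem_boundaryRestriction_domain.1 v.2
    rw [hBA.2 (y := x) hx.symm, hBA.2 (y := y) hy.symm, ← hx, ← hy, ← sub_eq_zero,
      ← boundaryForm_apply]
    obtain ⟨x₀, a, rfl, hx₀⟩ := hmax x hex
    rw [boundaryForm_add_left, hx₀, boundaryForm_smul_left, hey, mul_zero, add_zero]
  rw [LinearPMap.isSelfAdjoint_def]
  refine le_antisymm ?_ (hsymm.le_adjoint hBd)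
  have hw : ∀ y : B†.domain, ∀ u : A.domain, ⟪B† y, (u : E)⟫_ℂ = ⟪(y : E), A u⟫_ℂ := fun y u => by
    rw [hAB.2 (y := ⟨u, hAB.1 u.2⟩) rfl]
    exact LinearPMap.adjoint_isFormalAdjoint hBd y ⟨u, hAB.1 u.2⟩
  have hdomA : ∀ y : B†.domain, (y : E) ∈ A†.domain := fun y =>
    LinearPMap.mem_adjoint_domain_of_exists _ ⟨_, hw y⟩
  have hval : ∀ y : B†.domain, A† ⟨y, hdomA y⟩ = B† y := fun y =>
    LinearPMap.adjoint_apply_eq hA.1 _ (hw y)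
  have heB : (e : E) ∈ B.domain := mem_boundaryRestriction_domain.2 ⟨e, rfl, he⟩
  refine ⟨fun y hy => mem_boundaryRestriction_domain.2 ⟨⟨y, hdomA ⟨y, hy⟩⟩, rfl, ?_⟩, ?_⟩
  · rw [boundaryForm_apply, hval ⟨y, hy⟩, sub_eq_zero, ← hBA.2 (x := ⟨e, heB⟩) rfl]
    exact (LinearPMap.adjoint_isFormalAdjoint hBd).symm ⟨e, heB⟩ ⟨y, hy⟩
  · intro y v hyv
    rw [← hval y]
    exact (hBA.2 hyv.symm).symm

/-- With one-dimensional deficiency spaces spanned by `p` and `n`, the boundary conditions given by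
`p + n` and `p - n` (for unit vectors `p`, `n`) yield two different self-adjoint extensions. -/
theorem exists_two_selfAdjoint_extensions {A : E →ₗ.[ℂ] E} (hA : IsSymmetricOperator A) {p n : E}
    (hp0 : p ≠ 0) (hn0 : n ≠ 0) (hp : deficiencySpace A Complex.I = Submodule.span ℂ {p})
    (hn : deficiencySpace A (-Complex.I) = Submodule.span ℂ {n}) :
    ∃ B C : E →ₗ.[ℂ] E, B ≠ C ∧ A ≤ B ∧ A ≤ C ∧ IsSelfAdjoint B ∧ IsSelfAdjoint C := by
  obtain ⟨P, hP, hAP⟩ : p ∈ deficiencySpace A Complex.I :=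
    hp ▸ Submodule.mem_span_singleton_self p
  obtain ⟨N, hN, hAN⟩ : n ∈ deficiencySpace A (-Complex.I) :=
    hn ▸ Submodule.mem_span_singleton_self n
  have hpn : (‖p‖ : ℂ) ≠ 0 := by simpa using hp0
  have hnn : (‖n‖ : ℂ) ≠ 0 := by simpa using hn0
  set P' : A†.domain := (‖p‖ : ℂ)⁻¹ • P with hP'
  set N' : A†.domain := (‖n‖ : ℂ)⁻¹ • N with hN'
  have bPP : boundaryForm A P' P' = -2 * Complex.I := by
    rw [hP', boundaryForm_smul_left, map_smul,
      boundaryForm_of_eigen (z := Complex.I) (w := Complex.I) (by rw [hAP, hP]) (by rw [hAP, hP]),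
      hP, inner_self_eq_norm_sq_to_K]
    simp only [map_inv₀, Complex.conj_ofReal, Complex.conj_I, smul_eq_mul, Complex.coe_algebraMap]
    field_simp
    ring
  have bNN : boundaryForm A N' N' = 2 * Complex.I := by
    rw [hN', boundaryForm_smul_left, map_smul,
      boundaryForm_of_eigen (z := -Complex.I) (w := -Complex.I) (by rw [hAN, hN])
        (by rw [hAN, hN]), hN, inner_self_eq_norm_sq_to_K]
    simp only [map_inv₀, Complex.conj_ofReal, Complex.conj_I, smul_eq_mul, Complex.coe_algebraMap,
      map_neg]
    field_simp
    ring
  have bPN : boundaryForm A P' N' = 0 := by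
    rw [hP', hN', boundaryForm_smul_left, map_smul,
      boundaryForm_of_eigen (z := Complex.I) (w := -Complex.I) (by rw [hAP, hP]) (by rw [hAN, hN])]
    simp
  have bNP : boundaryForm A N' P' = 0 := boundaryForm_eq_zero_symm bPN
  have hdec : ∀ x : A†.domain, ∃ (x₀ : A†.domain) (a b : ℂ), x = x₀ + a • P' + b • N' ∧
      ∀ y, boundaryForm A x₀ y = 0 := by
    intro x
    obtain ⟨x₀, q, m, hx, hq, hm, hx₀⟩ := exists_vonNeumann_decomposition hA x
    rw [hp, Submodule.mem_span_singleton] at hq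
    rw [hn, Submodule.mem_span_singleton] at hm
    obtain ⟨a, ha⟩ := hq
    obtain ⟨b, hb⟩ := hm
    refine ⟨x₀, a * ‖p‖, b * ‖n‖, ?_, hx₀⟩
    rw [hx, hP', hN', smul_smul, smul_smul, mul_assoc, mul_assoc, mul_inv_cancel₀ hpn,
      mul_inv_cancel₀ hnn, mul_one, mul_one]
    congr 1
    · congr 1
      exact Subtype.ext (by simp [← ha, hP])
    · exact Subtype.ext (by simp [← hb, hN])
  -- For a sign `s`, the vector `p + s n` is null, and its boundary condition forces `b = s a`.
  have hsa : ∀ s : ℂ, conj s = s → s * s = 1 →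
      IsSelfAdjoint (boundaryRestriction A (P' + s • N')) := by
    intro s hs hss
    refine isSelfAdjoint_boundaryRestriction hA ?_ fun x hx => ?_
    · simp only [boundaryForm_add_left, boundaryForm_smul_left, map_add, map_smul, bPP, bNN, bPN,
        bNP, hs, smul_eq_mul]
      linear_combination 2 * Complex.I * hss
    · obtain ⟨x₀, a, b, rfl, hx₀⟩ := hdec x
      have h0 : boundaryForm A (P' + s • N') x₀ = 0 := boundaryForm_eq_zero_symm (hx₀ _)
      rw [map_add, map_add, h0] at hx
      simp only [boundaryForm_add_left, boundaryForm_smul_left, map_smul, bPP, bNN, bPN,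
        bNP, hs, smul_eq_mul] at hx
      have hab : b = a * s := by
        have h2 : s * b = a := by
          have : (2 * Complex.I) * (s * b - a) = 0 := by linear_combination hx
          rcases mul_eq_zero.1 this with h | h
          · simp at h
          · exact sub_eq_zero.1 h
        linear_combination s * h2 - b * hss
      refine ⟨x₀, a, ?_, hx₀⟩
      rw [hab]
      module
  refine ⟨boundaryRestriction A (P' + (1 : ℂ) • N'), boundaryRestriction A (P' + (-1 : ℂ) • N'),
    ?_, le_boundaryRestriction hA _, le_boundaryRestriction hA _, hsa 1 (by simp) (by simp),
    hsa (-1) (by simp) (by simp)⟩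
  intro h
  have h1 : ((P' + (-1 : ℂ) • N' : A†.domain) : E) ∈
      (boundaryRestriction A (P' + (-1 : ℂ) • N')).domain := by
    refine mem_boundaryRestriction_domain.2 ⟨_, rfl, ?_⟩
    simp only [boundaryForm_add_left, boundaryForm_smul_left, map_add, map_smul, bPP, bNN, bPN,
      bNP, smul_eq_mul, map_neg, map_one]
    ring
  rw [← h] at h1
  obtain ⟨y, hy, hey⟩ := mem_boundaryRestriction_domain.1 h1
  rw [Subtype.ext hy] at hey
  simp only [boundaryForm_add_left, boundaryForm_smul_left, map_add, map_smul, bPP, bNN, bPN,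
    bNP, smul_eq_mul, map_one] at hey
  have : (4 : ℂ) * Complex.I = 0 := by linear_combination -hey
  simp at this

end SelfAdjointExtension

/-! ### Primitives on the half-line -/

section HalfLine

/-- The fundamental theorem of calculus for absolutely continuous complex-valued functions. -/
lemma AbsolutelyContinuousOnInterval.sub_eq_integral {F G : ℝ → ℂ} {a b : ℝ} (ha : 0 ≤ a)
    (hab : a ≤ b) (hF : AbsolutelyContinuousOnInterval F a b) (hG : IntegrableOn G (Ioi 0))
    (hd : ∀ᵐ x : ℝ, x ∈ uIcc a b → HasDerivAt F (G x) x) :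
    F b - F a = ∫ t in a..b, G t := by
  have hb : 0 ≤ b := ha.trans hab
  have hi : IntervalIntegrable G volume 0 b := by
    rw [intervalIntegrable_iff, uIoc_of_le hb]
    exact hG.mono_set Ioc_subset_Ioi_self
  have hsub : uIcc a b ⊆ uIcc 0 b := by
    rw [uIcc_of_le hab, uIcc_of_le hb]
    exact Icc_subset_Icc_left ha
  have hac := hF.sub ((IsFiniteEnergy.ac_integral hi).mono hsub)
  obtain ⟨C, hC⟩ := hac.const_of_ae_hasDerivAt_zero (by
    filter_upwards [hd, hi.ae_hasDerivAt_integral] with x h1 h2 hx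
    simpa using (h1 hx).sub (h2 (hsub hx) 0 left_mem_uIcc))
  have e0 := hC a left_mem_uIcc
  have e1 := hC b right_mem_uIcc
  simp only [Pi.sub_apply] at e0 e1
  have hia : IntervalIntegrable G volume 0 a :=
    hi.mono_set (uIcc_subset_uIcc left_mem_uIcc (hsub left_mem_uIcc))
  rw [← intervalIntegral.integral_interval_sub_left hi hia]
  linear_combination e1 - e0

/-- `G` is an integrable function on `(0, ∞)` with primitive `F`. -/
structure IsHalfLinePrimitive (F G : ℝ → ℂ) : Prop where
  integrable : IntegrableOn G (Ioi 0)
  sub_eq : ∀ a b : ℝ, 0 < a → a ≤ b → F b - F a = ∫ t in a..b, G t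

namespace IsHalfLinePrimitive

variable {F G : ℝ → ℂ}

lemma of_hasDerivAt (hG : IntegrableOn G (Ioi 0)) (hd : ∀ r, 0 < r → HasDerivAt F (G r) r) :
    IsHalfLinePrimitive F G where
  integrable := hG
  sub_eq a b ha hab := by
    refine (intervalIntegral.integral_eq_sub_of_hasDerivAt (fun x hx => hd x ?_) ?_).symm
    · rw [uIcc_of_le hab] at hx
      exact ha.trans_le hx.1
    · rw [intervalIntegrable_iff, uIoc_of_le hab]
      exact hG.mono_set (Ioc_subset_Ioi_self.trans (Ioi_subset_Ioi ha.le))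

lemma tendsto_atTop (h : IsHalfLinePrimitive F G) :
    Tendsto F atTop (𝓝 (F 1 + ∫ t in Ioi (1 : ℝ), G t)) := by
  have h1 := intervalIntegral_tendsto_integral_Ioi (μ := volume) 1
    (h.integrable.mono_set (Ioi_subset_Ioi zero_le_one)) tendsto_id
  refine (h1.const_add (F 1)).congr' ?_
  filter_upwards [eventually_ge_atTop 1] with b hb
  rw [id, ← h.sub_eq 1 b one_pos hb]
  ring

lemma tendsto_zero (h : IsHalfLinePrimitive F G) :
    Tendsto F (𝓝[>] 0) (𝓝 (F 1 - ∫ t in (0 : ℝ)..1, G t)) := by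
  have hi : IntegrableOn G (uIcc 0 1) := by
    rw [uIcc_of_le zero_le_one, integrableOn_Icc_iff_integrableOn_Ioc]
    exact h.integrable.mono_set Ioc_subset_Ioi_self
  have h1 := (intervalIntegral.continuousOn_primitive_interval_left hi) 0 left_mem_uIcc
  have h2 : Tendsto (fun x => ∫ t in x..1, G t) (𝓝[>] 0) (𝓝 (∫ t in (0 : ℝ)..1, G t)) := by
    refine h1.mono_left ?_
    rw [uIcc_of_le zero_le_one, nhdsWithin_Icc_eq_nhdsGE zero_lt_one]
    exact nhdsWithin_mono _ Ioi_subset_Ici_self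
  refine (h2.const_sub (F 1)).congr' ?_
  filter_upwards [Ioo_mem_nhdsGT zero_lt_one] with a ha
  rw [← h.sub_eq a 1 ha.1 ha.2.le]
  ring

lemma integral_eq_sub (h : IsHalfLinePrimitive F G) {m₀ m₁ : ℂ} (h₀ : Tendsto F (𝓝[>] 0) (𝓝 m₀))
    (h₁ : Tendsto F atTop (𝓝 m₁)) : ∫ t in Ioi (0 : ℝ), G t = m₁ - m₀ := by
  rw [tendsto_nhds_unique h₀ h.tendsto_zero, tendsto_nhds_unique h₁ h.tendsto_atTop]
  have h2 : IntervalIntegrable G volume 0 1 := by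
    rw [intervalIntegrable_iff, uIoc_of_le zero_le_one]
    exact h.integrable.mono_set Ioc_subset_Ioi_self
  have h3 := h.integrable.mono_set (Ioi_subset_Ioi (zero_le_one (α := ℝ)))
  rw [← intervalIntegral.integral_interval_add_Ioi h.integrable h3]
  ring

/-- Since `1 / r` is not integrable along `l` (at infinity or at zero), a function `F` with
`F / r` integrable can only have the limit zero. -/
lemma limit_eq_zero {F : ℝ → ℂ} {l : Filter ℝ} [NeBot l] [TendstoIxxClass Icc l l]
    (hl : ∀ᶠ r in l, 0 < r) (hlog : Tendsto (fun r => ‖Real.log r‖) l atTop) {m : ℂ}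
    (hm : Tendsto F l (𝓝 m)) {k : Set ℝ} (hk : k ∈ l)
    (hF : IntegrableOn (fun r : ℝ => F r / (r : ℂ)) k) : m = 0 := by
  by_contra hm0
  refine not_integrableOn_of_tendsto_norm_atTop_of_deriv_isBigO_filter l hk ?_ hlog ?_ hF
  · filter_upwards [hl] with r hr using Real.differentiableAt_log hr.ne'
  · have hpos : 0 < ‖m‖ := norm_pos_iff.2 hm0
    refine Asymptotics.IsBigO.of_bound (2 / ‖m‖) ?_
    filter_upwards [hl, hm.norm.eventually (lt_mem_nhds (half_lt_self hpos))] with r hr h1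
    rw [Real.deriv_log, norm_div, Complex.norm_real, norm_inv, Real.norm_of_nonneg hr.le,
      ← mul_div_assoc, inv_eq_one_div]
    gcongr
    rw [div_mul_eq_mul_div, one_le_div hpos]
    linarith

lemma tendsto_atTop_zero (h : IsHalfLinePrimitive F G)
    (hF : IntegrableOn (fun r : ℝ => F r / (r : ℂ)) (Ioi 1)) : Tendsto F atTop (𝓝 0) := by
  have h1 := h.tendsto_atTop
  rwa [limit_eq_zero (eventually_gt_atTop 0)
    (tendsto_norm_atTop_atTop.comp Real.tendsto_log_atTop) h1 (Ioi_mem_atTop 1) hF] at h1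

lemma integral_eq_zero (h : IsHalfLinePrimitive F G)
    (hF : IntegrableOn (fun r : ℝ => F r / (r : ℂ)) (Ioi 0)) : ∫ t in Ioi (0 : ℝ), G t = 0 := by
  have h0 := h.tendsto_zero
  have hpos : ∀ᶠ r : ℝ in 𝓝[>] 0, 0 < r := self_mem_nhdsWithin
  rw [limit_eq_zero hpos (tendsto_abs_atBot_atTop.comp Real.tendsto_log_nhdsGT_zero) h0
    self_mem_nhdsWithin hF] at h0
  rw [h.integral_eq_sub h0 (h.tendsto_atTop_zero (hF.mono_set (Ioi_subset_Ioi zero_le_one))),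
    sub_zero]

end IsHalfLinePrimitive

end HalfLine

/-! ### The factorization `T = D D*` and the isometry onto `L²` -/

section Factorization

lemma AbsolutelyContinuousOnInterval.conj {u : ℝ → ℂ} {a b : ℝ}
    (hu : AbsolutelyContinuousOnInterval u a b) :
    AbsolutelyContinuousOnInterval (fun r => conj (u r)) a b := by
  rw [absolutelyContinuousOnInterval_iff] at hu ⊢
  simpa only [Complex.dist_conj_conj] using hu

lemma integrable_conj_mul {f g : ℝ → ℂ} (hf : MemLp f 2 halfLine) (hg : MemLp g 2 halfLine) :
    Integrable (fun r => conj (f r) * g r) halfLine :=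
  MemLp.integrable_mul hf.star hg

namespace EnergySpace

/-- The function `u' + u / r`, that is, `-D* u`, as an element of `L²`. -/
noncomputable def adjD : EnergySpace →ₗ[ℂ] Lp ℂ 2 halfLine where
  toFun u := derivLp u + divLp u
  map_add' u v := by rw [derivLp_add, divLp_add]; abel
  map_smul' a u := by rw [derivLp_smul, divLp_smul, RingHom.id_apply, smul_add]

lemma adjD_apply (u : EnergySpace) : adjD u = derivLp u + divLp u := rfl

lemma coeFn_adjD (u : EnergySpace) :
    adjD u =ᵐ[halfLine] fun r => deriv u.fn r + u.fn r / (r : ℂ) := by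
  filter_upwards [Lp.coeFn_add (derivLp u) (divLp u), u.prop.memLp_deriv.coeFn_toLp,
    u.prop.memLp_div.coeFn_toLp] with r h1 h2 h3
  rw [adjD_apply, h1, Pi.add_apply, derivLp, divLp, h2, h3]

lemma inner_derivLp_divLp_add (u v : EnergySpace) :
    ⟪derivLp u, divLp v⟫_ℂ + ⟪divLp u, derivLp v⟫_ℂ = ⟪divLp u, divLp v⟫_ℂ := by
  have hG1 := (integrable_conj_mul u.prop.memLp_deriv v.prop.memLp_div).add
    (integrable_conj_mul u.prop.memLp_div v.prop.memLp_deriv)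
  have hG2 := integrable_conj_mul u.prop.memLp_div v.prop.memLp_div
  -- The difference of both sides is the integral of `(ū v / r)'`.
  have hprim : IsHalfLinePrimitive (fun r => (conj (u.fn r) * v.fn r) * (r : ℂ)⁻¹)
      (fun r => (conj (deriv u.fn r) * (v.fn r / r) + conj (u.fn r / r) * deriv v.fn r)
        - conj (u.fn r / r) * (v.fn r / r)) := by
    refine ⟨hG1.sub hG2, fun a b ha hab => ?_⟩
    have hb : 0 < b := ha.trans_le hab
    have hsub : uIcc a b ⊆ uIcc 0 b := by
      rw [uIcc_of_le hab, uIcc_of_le hb.le]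
      exact Icc_subset_Icc_left ha.le
    have hinv : AbsolutelyContinuousOnInterval (fun r : ℝ => (r : ℂ)⁻¹) a b := by
      refine ContDiffOn.absolutelyContinuousOnInterval fun r hr => ContDiffAt.contDiffWithinAt ?_
      rw [uIcc_of_le hab] at hr
      have hr0 : (r : ℂ) ≠ 0 := by exact_mod_cast (ha.trans_le hr.1).ne'
      exact Complex.ofRealCLM.contDiff.contDiffAt.inv hr0
    refine AbsolutelyContinuousOnInterval.sub_eq_integral ha.le hab
      (((u.prop.ac b hb).mono hsub).conj.smul ((v.prop.ac b hb).mono hsub) |>.smul hinv)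
      (hG1.sub hG2) ?_
    have h1 := IsFiniteEnergy.ae_differentiableAt u.prop.ac
    have h2 := IsFiniteEnergy.ae_differentiableAt v.prop.ac
    rw [ae_restrict_iff' measurableSet_Ioi] at h1 h2
    filter_upwards [h1, h2] with r k1 k2 hr
    rw [uIcc_of_le hab] at hr
    have hr0 : 0 < r := ha.trans_le hr.1
    have hrc : (r : ℂ) ≠ 0 := by exact_mod_cast hr0.ne'
    have d1 := (k1 hr0).hasDerivAt.star
    have d2 := (k2 hr0).hasDerivAt
    have d3 : HasDerivAt (fun r : ℝ => (r : ℂ)⁻¹) (-((r : ℂ) ^ 2)⁻¹) r :=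
      (hasDerivAt_inv hrc).comp_ofReal
    refine ((d1.mul d2).mul d3).congr_deriv ?_
    simp only [Complex.star_def, Pi.mul_apply, map_div₀, Complex.conj_ofReal]
    field_simp
    ring
  have h0 := hprim.integral_eq_zero (by
    refine hG2.congr ?_
    filter_upwards with r
    simp only [map_div₀, Complex.conj_ofReal]
    ring)
  rw [L2.inner_def, L2.inner_def, L2.inner_def,
    ← integral_add (L2.integrable_inner _ _) (L2.integrable_inner _ _), ← sub_eq_zero,
    ← integral_sub ((L2.integrable_inner _ _).add (L2.integrable_inner _ _))
      (L2.integrable_inner _ _), ← h0]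
  refine integral_congr_ae ?_
  filter_upwards [u.prop.memLp_deriv.coeFn_toLp, v.prop.memLp_deriv.coeFn_toLp,
    u.prop.memLp_div.coeFn_toLp, v.prop.memLp_div.coeFn_toLp] with r h1 h2 h3 h4
  simp only [derivLp, divLp, h1, h2, h3, h4, RCLike.inner_apply]
  ring

/-- `D*` is isometric from the energy space to `L²`, as `T = D D*`. -/
lemma inner_adjD (u v : EnergySpace) : ⟪adjD u, adjD v⟫_ℂ = ⟪u, v⟫_ℂ := by
  rw [inner_eq, energyInner_eq, adjD_apply, adjD_apply, inner_add_left, inner_add_right,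
    inner_add_right]
  linear_combination inner_derivLp_divLp_add u v

lemma adjD_injective : Function.Injective adjD := by
  rw [← LinearMap.ker_eq_bot, LinearMap.ker_eq_bot']
  intro u hu
  rw [← inner_self_eq_zero (𝕜 := ℂ), ← inner_adjD, hu, inner_zero_left]

end EnergySpace

end Factorization

/-! ### Smooth functions and the symmetry of `T` -/

section Smooth

variable {u : ℝ → ℂ}

lemma hasDerivAt_of_smooth (hu : ContDiffOn ℝ ∞ u (Ici 0)) {r : ℝ} (hr : 0 < r) :
    HasDerivAt u (deriv u r) r :=
  ((hu.contDiffAt (Ici_mem_nhds hr)).differentiableAt (by simp)).hasDerivAt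

lemma contDiffAt_deriv_of_smooth (hu : ContDiffOn ℝ ∞ u (Ici 0)) {r : ℝ} (hr : 0 < r) :
    ContDiffAt ℝ ∞ (deriv u) r :=
  (((contDiffOn_infty_iff_deriv_of_isOpen isOpen_Ioi).1
    (hu.mono Ioi_subset_Ici_self)).2).contDiffAt (Ioi_mem_nhds hr)

lemma hasDerivAt_deriv_of_smooth (hu : ContDiffOn ℝ ∞ u (Ici 0)) {r : ℝ} (hr : 0 < r) :
    HasDerivAt (deriv u) (2 / (r : ℂ) ^ 2 * u r - radialT u r) r := by
  have h1 := ((contDiffAt_deriv_of_smooth hu hr).differentiableAt (by simp)).hasDerivAt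
  refine h1.congr_deriv ?_
  rw [radialT, if_pos hr, iteratedDeriv_succ, iteratedDeriv_one]
  ring

lemma hasDerivAt_radialT_of_smooth (hu : ContDiffOn ℝ ∞ u (Ici 0)) {r : ℝ} (hr : 0 < r) :
    HasDerivAt (radialT u) (deriv (radialT u) r) r := by
  have h0 : ContDiffOn ℝ ∞ (deriv u) (Ioi 0) := fun x hx =>
    (contDiffAt_deriv_of_smooth hu hx).contDiffWithinAt
  have h1 : ContDiffAt ℝ ∞ (deriv (deriv u)) r :=
    ((contDiffOn_infty_iff_deriv_of_isOpen isOpen_Ioi).1 h0).2.contDiffAt (Ioi_mem_nhds hr)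
  have hrc : (r : ℂ) ≠ 0 := by exact_mod_cast hr.ne'
  have h2 : DifferentiableAt ℝ (fun s : ℝ => -deriv (deriv u) s + 2 / (s : ℂ) ^ 2 * u s) r := by
    refine (h1.differentiableAt (by simp)).neg.add
      (DifferentiableAt.mul ?_ (hasDerivAt_of_smooth hu hr).differentiableAt)
    exact (differentiableAt_const _).div
      (Complex.ofRealCLM.differentiableAt.pow 2) (pow_ne_zero 2 hrc)
  refine (h2.congr_of_eventuallyEq ?_).hasDerivAt
  filter_upwards [Ioi_mem_nhds hr] with s hs
  rw [radialT, if_pos (show 0 < s from hs), iteratedDeriv_succ, iteratedDeriv_one]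

lemma operatorT0_fn (u : operatorT0.domain) : (operatorT0 u).fn = radialT (u : EnergySpace).fn :=
  rfl

/-- Green's formula; the boundary terms `(T u)‾ v' - ū' T v` vanish in the limit since, divided by
`r`, they are integrable. -/
lemma isFormalAdjoint_operatorT0 : operatorT0.IsFormalAdjoint operatorT0 := by
  intro u v
  have hus := u.2.1
  have hvs := v.2.1
  have hf : IsFiniteEnergy (radialT (u : EnergySpace).fn) := u.2.2.1
  have hg : IsFiniteEnergy (radialT (v : EnergySpace).fn) := v.2.2.1
  have hu := (u : EnergySpace).prop
  have hv := (v : EnergySpace).prop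
  rw [EnergySpace.inner_eq, EnergySpace.inner_eq, EnergySpace.energyInner,
    EnergySpace.energyInner, operatorT0_fn, operatorT0_fn]
  set U := (u : EnergySpace).fn
  set V := (v : EnergySpace).fn
  have hint : ∀ {a b : ℝ → ℂ}, IsFiniteEnergy a → IsFiniteEnergy b →
      Integrable (fun r : ℝ => conj (deriv a r) * deriv b r
        + 2 / (r : ℂ) ^ 2 * (conj (a r) * b r)) halfLine := by
    intro a b ha hb
    refine ((integrable_conj_mul ha.memLp_deriv hb.memLp_deriv).add
      ((integrable_conj_mul ha.memLp_div hb.memLp_div).const_mul 2)).congr ?_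
    filter_upwards with r
    simp only [Pi.add_apply, map_div₀, Complex.conj_ofReal]
    ring
  have i1 := hint hf hv
  have i2 := hint hu hg
  rw [← sub_eq_zero, ← integral_sub i1 i2]
  have hprim : IsHalfLinePrimitive
      (fun r => conj (radialT U r) * deriv V r - conj (deriv U r) * radialT V r) _ :=
    .of_hasDerivAt (i1.sub i2) fun r hr => by
      have hrc : (r : ℂ) ≠ 0 := by exact_mod_cast hr.ne'
      have d1 := (hasDerivAt_radialT_of_smooth hus hr).star
      have d2 := hasDerivAt_deriv_of_smooth hvs hr
      have d3 := (hasDerivAt_deriv_of_smooth hus hr).star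
      have d4 := hasDerivAt_radialT_of_smooth hvs hr
      refine ((d1.mul d2).sub (d3.mul d4)).congr_deriv ?_
      simp only [Complex.star_def, Pi.sub_apply, map_sub, map_mul, map_div₀, map_pow,
        Complex.conj_ofReal, Complex.conj_ofNat]
      ring
  refine hprim.integral_eq_zero ?_
  refine ((integrable_conj_mul hf.memLp_div hv.memLp_deriv).sub
    (integrable_conj_mul hu.memLp_deriv hg.memLp_div)).congr ?_
  filter_upwards with r
  simp only [Pi.sub_apply, map_div₀, Complex.conj_ofReal]
  ring

end Smooth

/-! ### Test functions on the open half-line -/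

section TestFunctions

/-- Complex-valued smooth functions with compact support in `(0, ∞)`, as functions on `ℝ`. -/
def testFunctions : Submodule ℂ (ℝ → ℂ) where
  carrier := {g | ContDiff ℝ ∞ g ∧ ∃ a b : ℝ, 0 < a ∧ ∀ r, r ∉ Icc a b → g r = 0}
  zero_mem' := ⟨contDiff_const, 1, 1, one_pos, fun _ _ => rfl⟩
  add_mem' := by
    rintro f g ⟨hf, a, b, ha, hab⟩ ⟨hg, c, d, hc, hcd⟩
    refine ⟨hf.add hg, min a c, max b d, lt_min ha hc, fun r hr => ?_⟩
    rw [Pi.add_apply, hab r fun h => hr ⟨(min_le_left _ _).trans h.1, h.2.trans (le_max_left _ _)⟩,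
      hcd r fun h => hr ⟨(min_le_right _ _).trans h.1, h.2.trans (le_max_right _ _)⟩, add_zero]
  smul_mem' := by
    rintro c f ⟨hf, a, b, ha, hab⟩
    exact ⟨hf.const_smul c, a, b, ha, fun r hr => by rw [Pi.smul_apply, hab r hr, smul_zero]⟩

namespace testFunctions

variable {g : ℝ → ℂ}

lemma eq_zero_of_nonpos (hg : g ∈ testFunctions) {r : ℝ} (hr : r ≤ 0) : g r = 0 := by
  obtain ⟨-, a, b, ha, hab⟩ := hg
  exact hab r fun h => absurd (h.1.trans hr) (not_le.2 ha)

lemma hasCompactSupport (hg : g ∈ testFunctions) : HasCompactSupport g := by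
  obtain ⟨-, a, b, ha, hab⟩ := hg
  exact HasCompactSupport.intro isCompact_Icc hab

lemma integrable_mul (hg : g ∈ testFunctions) {h : ℝ → ℂ} (hh : LocallyIntegrable h halfLine) :
    Integrable (fun r => h r * g r) halfLine :=
  hh.integrable_smul_right_of_hasCompactSupport hg.1.continuous (hasCompactSupport hg)

lemma memLp (hg : g ∈ testFunctions) : MemLp g 2 halfLine :=
  hg.1.continuous.memLp_of_hasCompactSupport (hasCompactSupport hg)

lemma integrable (hg : g ∈ testFunctions) : Integrable g halfLine :=
  hg.1.continuous.integrable_of_hasCompactSupport (hasCompactSupport hg)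

lemma hasDerivAt (hg : g ∈ testFunctions) (r : ℝ) : HasDerivAt g (deriv g r) r :=
  (hg.1.differentiable (by simp) r).hasDerivAt

lemma deriv_mem (hg : g ∈ testFunctions) : deriv g ∈ testFunctions := by
  obtain ⟨hs, a, b, ha, hab⟩ := hg
  refine ⟨(contDiff_infty_iff_deriv.1 hs).2, a, b, ha, fun r hr => ?_⟩
  have : g =ᶠ[𝓝 r] fun _ => 0 := by
    filter_upwards [isClosed_Icc.isOpen_compl.mem_nhds hr] with x hx using hab x hx
  rw [this.deriv_eq, deriv_const]

lemma mul_mem (hg : g ∈ testFunctions) {h : ℝ → ℂ} (hh : ContDiffOn ℝ ∞ h (Ioi 0)) :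
    (fun r => h r * g r) ∈ testFunctions := by
  obtain ⟨hs, a, b, ha, hab⟩ := hg
  refine ⟨contDiff_iff_contDiffAt.2 fun r => ?_, a, b, ha, fun r hr => by
    simp only [hab r hr, mul_zero]⟩
  rcases lt_or_ge 0 r with hr | hr
  · exact (hh.contDiffAt (Ioi_mem_nhds hr)).mul hs.contDiffAt
  · refine (contDiffAt_const (c := (0 : ℂ))).congr_of_eventuallyEq ?_
    filter_upwards [Iio_mem_nhds (hr.trans_lt ha)] with x hx
    rw [hab x fun h => absurd h.1 (not_le.2 hx), mul_zero]

lemma contDiffOn_inv : ContDiffOn ℝ ∞ (fun r : ℝ => (r : ℂ)⁻¹) (Ioi 0) := fun r hr => by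
  have hr0 : (r : ℂ) ≠ 0 := by exact_mod_cast (ne_of_gt (mem_Ioi.1 hr))
  exact (Complex.ofRealCLM.contDiff.contDiffAt.inv hr0).contDiffWithinAt

lemma div_mem (hg : g ∈ testFunctions) : (fun r : ℝ => g r / (r : ℂ)) ∈ testFunctions := by
  refine (congrArg (· ∈ testFunctions) (funext fun r => ?_)).mp (mul_mem hg contDiffOn_inv)
  rw [div_eq_inv_mul]

/-- The integral of the derivative of a test function vanishes. -/
lemma integral_eq_zero {G : ℝ → ℂ} (hG : G ∈ testFunctions) (hg : g ∈ testFunctions)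
    (hd : ∀ r, 0 < r → HasDerivAt G (g r) r) : ∫ r in Ioi (0 : ℝ), g r = 0 :=
  (IsHalfLinePrimitive.of_hasDerivAt (integrable hg) hd).integral_eq_zero (integrable (div_mem hG))

lemma exists_primitive (hg : g ∈ testFunctions) (h0 : ∫ r in Ioi (0 : ℝ), g r = 0) :
    ∃ G ∈ testFunctions, ∀ r, HasDerivAt G (g r) r := by
  have hd : ∀ r, HasDerivAt (fun x => ∫ t in (0 : ℝ)..x, g t) (g r) r := fun r =>
    hg.1.continuous.integral_hasStrictDerivAt 0 r |>.hasDerivAt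
  refine ⟨fun x => ∫ t in (0 : ℝ)..x, g t, ⟨?_, ?_⟩, hd⟩
  · refine contDiff_infty_iff_deriv.2 ⟨fun r => (hd r).differentiableAt, ?_⟩
    rw [show deriv (fun x => ∫ t in (0 : ℝ)..x, g t) = g from funext fun r => (hd r).deriv]
    exact hg.1
  · obtain ⟨a, b, ha, hab⟩ := hg.2
    refine ⟨a, max a b, ha, fun r hr => ?_⟩
    rcases lt_or_ge r a with h | h
    · have : EqOn g 0 (uIcc 0 r) := fun x hx => hab x fun hx' =>
        absurd (hx'.1.trans hx.2) (not_le.2 (max_lt ha h))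
      exact (intervalIntegral.integral_congr this).trans intervalIntegral.integral_zero
    · have hr' : max a b < r := not_le.1 fun h' => hr ⟨h, h'⟩
      have hrb : b < r := (le_max_right _ _).trans_lt hr'
      have hint : IntegrableOn g (Ioi 0) := integrable hg
      have h1 := intervalIntegral.integral_interval_add_Ioi hint
        (hint.mono_set (Ioi_subset_Ioi (ha.le.trans h)))
      have h2 : ∫ t in Ioi r, g t = 0 := setIntegral_eq_zero_of_forall_eq_zero fun x hx =>
        hab x fun hx' => absurd (hrb.trans hx) (not_lt.2 hx'.2)
      rw [h0, h2, add_zero] at h1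
      exact h1

/-- A function which is orthogonal to all test functions orthogonal to finitely many functions
`h i` is a linear combination of the `h i`. -/
lemma exists_ae_eq_sum {ι : Type*} [Fintype ι] {h : ι → ℝ → ℂ}
    (hh : ∀ i, LocallyIntegrable (h i) halfLine) {v : ℝ → ℂ} (hv : LocallyIntegrable v halfLine)
    (H : ∀ g ∈ testFunctions, (∀ i, ∫ r in Ioi (0 : ℝ), h i r * g r = 0) →
      ∫ r in Ioi (0 : ℝ), v r * g r = 0) :
    ∃ c : ι → ℂ, v =ᵐ[halfLine] fun r => ∑ i, c i * h i r := by
  let L : ∀ f : ℝ → ℂ, LocallyIntegrable f halfLine → testFunctions →ₗ[ℂ] ℂ := fun f hf =>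
    { toFun := fun g => ∫ r in Ioi (0 : ℝ), f r * (g : ℝ → ℂ) r
      map_add' := fun g g' => by
        rw [← integral_add (integrable_mul g.2 hf) (integrable_mul g'.2 hf)]
        simp only [Submodule.coe_add, Pi.add_apply, mul_add]
      map_smul' := fun c g => by
        rw [RingHom.id_apply, smul_eq_mul, ← integral_const_mul]
        simp only [Submodule.coe_smul, Pi.smul_apply, smul_eq_mul, mul_left_comm] }
  have hmem : L v hv ∈ Submodule.span ℂ (range fun i => L (h i) (hh i)) := by
    refine mem_span_of_iInf_ker_le_ker fun g hg => ?_
    rw [Submodule.mem_iInf] at hg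
    exact H g g.2 fun i => hg i
  obtain ⟨c, hc⟩ := (Submodule.mem_span_range_iff_exists_fun ℂ).1 hmem
  refine ⟨c, ?_⟩
  have hsum : LocallyIntegrable (fun r => ∑ i, c i * h i r) halfLine :=
    locallyIntegrable_finsetSum _ fun i _ => (hh i).smul (c i)
  have hzero := isOpen_Ioi.ae_eq_zero_of_integral_contDiff_smul_eq_zero (μ := halfLine)
    (U := Ioi (0 : ℝ)) ((hv.sub hsum).locallyIntegrableOn _) (by
      intro φ hφ hφc hφs
      have hφT : (fun r => (φ r : ℂ)) ∈ testFunctions := by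
        refine ⟨Complex.ofRealCLM.contDiff.comp hφ, ?_⟩
        rcases (tsupport φ).eq_empty_or_nonempty with he | hne
        · exact ⟨1, 1, one_pos, fun r _ => by
            have : r ∉ tsupport φ := he ▸ notMem_empty r
            simp only [image_eq_zero_of_notMem_tsupport this, Complex.ofReal_zero]⟩
        · have hK : IsCompact (tsupport φ) := hφc
          refine ⟨sInf (tsupport φ), sSup (tsupport φ), hφs (hK.sInf_mem hne), fun r hr => ?_⟩
          have : r ∉ tsupport φ := fun h' =>
            hr ⟨csInf_le hK.bddBelow h', le_csSup hK.bddAbove h'⟩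
          simp only [image_eq_zero_of_notMem_tsupport this, Complex.ofReal_zero]
      have e1 : L v hv ⟨_, hφT⟩ = ∑ i, c i • L (h i) (hh i) ⟨_, hφT⟩ := by
        rw [← hc]
        simp
      change ∫ r in Ioi (0 : ℝ), v r * (φ r : ℂ)
        = ∑ i, c i * ∫ r in Ioi (0 : ℝ), h i r * (φ r : ℂ) at e1
      simp_rw [← integral_const_mul] at e1
      rw [← integral_finsetSum _ fun i _ => (integrable_mul hφT (hh i)).const_mul (c i),
        ← sub_eq_zero, ← integral_sub (integrable_mul hφT hv)
          (integrable_finsetSum _ fun i _ => (integrable_mul hφT (hh i)).const_mul (c i))] at e1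
      rw [← e1]
      refine integral_congr_ae (Eventually.of_forall fun r => ?_)
      simp only [Pi.sub_apply, Complex.real_smul, ← mul_assoc, ← Finset.sum_mul]
      ring)
  filter_upwards [hzero, ae_restrict_mem measurableSet_Ioi] with r h1 h2
  exact sub_eq_zero.1 (h1 h2)

lemma contDiff_cexp (k : ℂ) : ContDiff ℝ ∞ fun r : ℝ => Complex.exp (k * r) :=
  (contDiff_const.mul Complex.ofRealCLM.contDiff).cexp

lemma hasDerivAt_cexp (k : ℂ) (r : ℝ) :
    HasDerivAt (fun r : ℝ => Complex.exp (k * r)) (k * Complex.exp (k * r)) r := by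
  have h1 : HasDerivAt (fun z : ℂ => Complex.exp (k * z)) (Complex.exp (k * r) * (k * 1)) r :=
    ((hasDerivAt_id (r : ℂ)).const_mul k).cexp
  exact h1.comp_ofReal.congr_deriv (by ring)

/-- Solvability of `-η'' + κ² η = g` in test functions, by inverting the first-order factors of
`-(d/dr - κ) (d/dr + κ)` one after the other. -/
lemma exists_helmholtz {κ : ℂ} (hκ : κ ≠ 0) (hg : g ∈ testFunctions)
    (hp : ∫ r in Ioi (0 : ℝ), Complex.exp (κ * r) * g r = 0)
    (hm : ∫ r in Ioi (0 : ℝ), Complex.exp (-κ * r) * g r = 0) :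
    ∃ η ∈ testFunctions, ∃ η' ∈ testFunctions, (∀ r, HasDerivAt η (η' r) r) ∧
      ∀ r, HasDerivAt η' (κ ^ 2 * η r - g r) r := by
  have hexp : ∀ r : ℝ, Complex.exp (κ * r) * Complex.exp (-κ * r) = 1 := fun r => by
    rw [← Complex.exp_add]
    simp
  obtain ⟨P, hP, hPd⟩ := exists_primitive (mul_mem hg (contDiff_cexp (-κ)).contDiffOn) hm
  set η₁ : ℝ → ℂ := fun r => -(Complex.exp (κ * r) * P r) with hη₁
  have hη₁T : η₁ ∈ testFunctions :=
    testFunctions.neg_mem (mul_mem hP (contDiff_cexp κ).contDiffOn)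
  have hη₁d : ∀ r, HasDerivAt η₁ (κ * η₁ r - g r) r := fun r => by
    refine ((hasDerivAt_cexp κ r).mul (hPd r)).neg.congr_deriv ?_
    simp only [hη₁]
    linear_combination -g r * hexp r
  have hκη₁ : (fun r : ℝ => Complex.exp (κ * r) * η₁ r) ∈ testFunctions :=
    mul_mem hη₁T (contDiff_cexp κ).contDiffOn
  have hκg : (fun r : ℝ => Complex.exp (κ * r) * g r) ∈ testFunctions :=
    mul_mem hg (contDiff_cexp κ).contDiffOn
  -- `(e^{κ r} η₁)' = 2 κ e^{κ r} η₁ - e^{κ r} g`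
  have hη₁0 : ∫ r in Ioi (0 : ℝ), Complex.exp (κ * r) * η₁ r = 0 := by
    have h1 := integral_eq_zero hκη₁
      (testFunctions.sub_mem (testFunctions.smul_mem (2 * κ) hκη₁) hκg) fun r _ => by
        refine ((hasDerivAt_cexp κ r).mul (hη₁d r)).congr_deriv ?_
        simp only [Pi.sub_apply, Pi.smul_apply, smul_eq_mul]
        ring
    simp only [Pi.sub_apply, Pi.smul_apply, smul_eq_mul] at h1
    rw [integral_sub ((integrable hκη₁).const_mul _) (integrable hκg), integral_const_mul, hp,
      sub_zero] at h1
    exact (mul_eq_zero.1 h1).resolve_left (mul_ne_zero two_ne_zero hκ)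
  obtain ⟨Q, hQ, hQd⟩ := exists_primitive hκη₁ hη₁0
  have hηd : ∀ r : ℝ, HasDerivAt (fun r : ℝ => Complex.exp (-κ * r) * Q r)
      (-κ * (Complex.exp (-κ * r) * Q r) + η₁ r) r := fun r => by
    refine ((hasDerivAt_cexp (-κ) r).mul (hQd r)).congr_deriv ?_
    linear_combination η₁ r * hexp r
  have hηT : (fun r : ℝ => Complex.exp (-κ * r) * Q r) ∈ testFunctions :=
    mul_mem hQ (contDiff_cexp (-κ)).contDiffOn
  refine ⟨_, hηT, _, testFunctions.add_mem (testFunctions.smul_mem (-κ) hηT) hη₁T, hηd, fun r => ?_⟩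
  refine (((hηd r).const_mul (-κ)).add (hη₁d r)).congr_deriv ?_
  ring

/-- Every test function orthogonal to `r` is `φ' + φ / r` for some test function `φ`. -/
lemma exists_deriv_add_div_eq (hg : g ∈ testFunctions)
    (hr : ∫ r in Ioi (0 : ℝ), (r : ℂ) * g r = 0) :
    ∃ φ ∈ testFunctions, ∀ r, 0 < r → deriv φ r + φ r / (r : ℂ) = g r := by
  have hrs : ContDiff ℝ ∞ fun r : ℝ => (r : ℂ) := Complex.ofRealCLM.contDiff
  obtain ⟨χ, hχ, hχd⟩ := exists_primitive (mul_mem hg hrs.contDiffOn) hr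
  refine ⟨_, div_mem hχ, fun r hr => ?_⟩
  have hrc : (r : ℂ) ≠ 0 := by exact_mod_cast hr.ne'
  have hid : HasDerivAt (fun r : ℝ => (r : ℂ)) 1 r := (hasDerivAt_id (r : ℂ)).comp_ofReal
  have hdiv : HasDerivAt (fun r : ℝ => χ r / (r : ℂ)) _ r := (hχd r).div hid hrc
  rw [hdiv.deriv]
  field_simp
  ring

/-- A test function orthogonal to `r` and `e^{±κ r}` is `-η'' + κ² η` for some `η = φ' + φ / r`
with a test function `φ`. -/
lemma exists_solution {κ : ℂ} (hκ : κ ≠ 0) (hg : g ∈ testFunctions)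
    (hr : ∫ r in Ioi (0 : ℝ), (r : ℂ) * g r = 0)
    (hp : ∫ r in Ioi (0 : ℝ), Complex.exp (κ * r) * g r = 0)
    (hm : ∫ r in Ioi (0 : ℝ), Complex.exp (-κ * r) * g r = 0) :
    ∃ φ ∈ testFunctions, ∃ η' : ℝ → ℂ,
      (∀ r, 0 < r → HasDerivAt (fun r => deriv φ r + φ r / (r : ℂ)) (η' r) r) ∧
      ∀ r, 0 < r → HasDerivAt η' (κ ^ 2 * (deriv φ r + φ r / (r : ℂ)) - g r) r := by
  obtain ⟨η, hη, η', hη', hd, hd'⟩ := exists_helmholtz hκ hg hp hm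
  have hrs : ContDiff ℝ ∞ fun r : ℝ => (r : ℂ) := Complex.ofRealCLM.contDiff
  have hid : ∀ r : ℝ, HasDerivAt (fun r : ℝ => (r : ℂ)) 1 r := fun r =>
    (hasDerivAt_id (r : ℂ)).comp_ofReal
  have hrη := mul_mem hη hrs.contDiffOn
  have hrg := mul_mem hg hrs.contDiffOn
  -- `(r η' - η)' = r η'' = κ² r η - r g`
  have hη0 : ∫ r in Ioi (0 : ℝ), (r : ℂ) * η r = 0 := by
    have h1 := integral_eq_zero (testFunctions.sub_mem (mul_mem hη' hrs.contDiffOn) hη)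
      (testFunctions.sub_mem (testFunctions.smul_mem (κ ^ 2) hrη) hrg) fun r _ => by
        refine (((hid r).mul (hd' r)).sub (hd r)).congr_deriv ?_
        simp only [Pi.sub_apply, Pi.smul_apply, smul_eq_mul]
        ring
    simp only [Pi.sub_apply, Pi.smul_apply, smul_eq_mul] at h1
    rw [integral_sub ((integrable hrη).const_mul _) (integrable hrg), integral_const_mul, hr,
      sub_zero] at h1
    exact (mul_eq_zero.1 h1).resolve_left (pow_ne_zero 2 hκ)
  obtain ⟨φ, hφ, hφη⟩ := exists_deriv_add_div_eq hη hη0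
  refine ⟨φ, hφ, η', fun r hr => (hd r).congr_of_eventuallyEq ?_, fun r hr => ?_⟩
  · filter_upwards [Ioi_mem_nhds hr] with x hx using hφη x hx
  · rw [hφη r hr]
    exact hd' r

end testFunctions

end TestFunctions

/-! ### The decaying solutions -/

section DecayingSolution

lemma hasDerivAt_sub_one_mul_exp_add_one (z : ℂ) :
    HasDerivAt (fun z : ℂ => (z - 1) * Complex.exp z + 1) (z * Complex.exp z) z := by
  refine ((((hasDerivAt_id z).sub_const 1).mul (Complex.hasDerivAt_exp z)).add_const 1).congr_deriv
    ?_
  simp only [id]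
  ring

lemma norm_exp_le_one {z : ℂ} (hz : z.re ≤ 0) : ‖Complex.exp z‖ ≤ 1 := by
  rw [Complex.norm_exp]
  exact Real.exp_le_one_iff.2 hz

lemma norm_sub_one_mul_exp_add_one_le {z : ℂ} (hz : z.re ≤ 0) :
    ‖(z - 1) * Complex.exp z + 1‖ ≤ ‖z‖ ^ 2 := by
  have hs : Convex ℝ ({w : ℂ | w.re ≤ 0} ∩ Metric.closedBall 0 ‖z‖) :=
    (convex_halfSpace_re_le 0).inter (convex_closedBall 0 ‖z‖)
  have h := hs.norm_image_sub_le_of_norm_hasDerivWithin_le (C := ‖z‖)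
    (fun w _ => (hasDerivAt_sub_one_mul_exp_add_one w).hasDerivWithinAt)
    (fun w hw => by
      rw [norm_mul]
      exact (mul_le_of_le_one_right (norm_nonneg w) (norm_exp_le_one hw.1)).trans
        (mem_closedBall_zero_iff.1 hw.2))
    (x := 0) (y := z) ⟨by simp, by simp⟩ ⟨hz, by simp⟩
  simpa [sq] using h

variable {k : ℂ}

/-- The function `D exp(k r) + 1 / r = ((k r - 1) exp(k r) + 1) / r` on `(0, ∞)`, extended by
zero. -/
noncomputable def decayingSolution (k : ℂ) (r : ℝ) : ℂ :=
  if 0 < r then ((k * r - 1) * Complex.exp (k * r) + 1) / r else 0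

lemma decayingSolution_of_pos {r : ℝ} (hr : 0 < r) :
    decayingSolution k r = ((k * r - 1) * Complex.exp (k * r) + 1) / r := if_pos hr

lemma hasDerivAt_decayingSolution {r : ℝ} (hr : 0 < r) :
    HasDerivAt (decayingSolution k)
      (k ^ 2 * Complex.exp (k * r) - decayingSolution k r / r) r := by
  have hrc : (r : ℂ) ≠ 0 := by exact_mod_cast hr.ne'
  have hid : HasDerivAt (fun r : ℝ => (r : ℂ)) 1 r := (hasDerivAt_id (r : ℂ)).comp_ofReal
  have h1 : HasDerivAt (fun r : ℝ => (k * r - 1) * Complex.exp (k * r) + 1) _ r :=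
    (((hid.const_mul k).sub_const 1).mul (testFunctions.hasDerivAt_cexp k r)).add_const 1
  have h2 : HasDerivAt
      (fun r : ℝ => ((k * r - 1) * Complex.exp (k * r) + 1) / (r : ℂ)) _ r := h1.div hid hrc
  refine (h2.congr_of_eventuallyEq ?_).congr_deriv ?_
  · filter_upwards [Ioi_mem_nhds hr] with x hx using decayingSolution_of_pos hx
  · rw [decayingSolution_of_pos hr]
    field_simp
    ring

/-- The numerator of `((k r - 1) exp(k r) + 1) / r²` is at most `|k r|²`, and it is bounded on the
whole half-line. -/
lemma exists_norm_decayingSolution_div_le (hk : k.re < 0) :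
    ∃ M : ℝ, ∀ r : ℝ, 0 < r → ‖decayingSolution k r / (r : ℂ)‖ ≤ M * (1 + r ^ 2)⁻¹ := by
  refine ⟨‖k‖ ^ 2 + (‖k‖ / -k.re + 2), fun r hr => ?_⟩
  have hre : (k * r).re = k.re * r := by simp
  have hkr : (k * r).re ≤ 0 := by
    rw [hre]
    exact mul_nonpos_of_nonpos_of_nonneg hk.le hr.le
  have h1 := norm_sub_one_mul_exp_add_one_le hkr
  have h2 : ‖(k * r - 1) * Complex.exp (k * r) + 1‖ ≤ ‖k‖ / -k.re + 2 := by
    have h3 : ‖k * r * Complex.exp (k * r)‖ ≤ ‖k‖ / -k.re := by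
      rw [norm_mul, norm_mul, Complex.norm_exp, hre, Complex.norm_real, Real.norm_of_nonneg hr.le,
        le_div_iff₀ (neg_pos.2 hk)]
      have h4 : -k.re * r ≤ Real.exp (-(k.re * r)) := by
        have := Real.add_one_le_exp (-(k.re * r))
        linarith
      have h5 : Real.exp (-(k.re * r)) * Real.exp (k.re * r) = 1 := by
        rw [← Real.exp_add]
        simp
      have h6 := mul_le_mul_of_nonneg_right h4 (Real.exp_pos (k.re * r)).le
      rw [h5] at h6
      nlinarith [norm_nonneg k]
    calc ‖(k * r - 1) * Complex.exp (k * r) + 1‖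
        = ‖k * r * Complex.exp (k * r) - Complex.exp (k * r) + 1‖ := by ring_nf
      _ ≤ ‖k * r * Complex.exp (k * r)‖ + ‖Complex.exp (k * r)‖ + ‖(1 : ℂ)‖ :=
        (norm_add_le _ _).trans (add_le_add_left (norm_sub_le _ _) _)
      _ ≤ ‖k‖ / -k.re + 1 + 1 := by
        gcongr
        · exact norm_exp_le_one hkr
        · simp
      _ = ‖k‖ / -k.re + 2 := by ring
  have hr2 : (0 : ℝ) < 1 + r ^ 2 := by positivity
  rw [decayingSolution_of_pos hr, norm_div, norm_div, Complex.norm_real,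
    Real.norm_of_nonneg hr.le, div_div, ← div_eq_mul_inv, div_le_div_iff₀ (by positivity) hr2]
  rw [norm_mul, Complex.norm_real, Real.norm_of_nonneg hr.le, mul_pow] at h1
  nlinarith [sq_nonneg r]

lemma memLp_exp (hk : k.re < 0) :
    MemLp (fun r : ℝ => Complex.exp (k * r)) 2 halfLine := by
  rw [memLp_two_iff_integrable_sq_norm
    (testFunctions.contDiff_cexp k).continuous.aestronglyMeasurable]
  refine (exp_neg_integrableOn_Ioi 0 (b := -(2 * k.re)) (by linarith)).congr ?_
  filter_upwards with r
  rw [Complex.norm_exp, ← Real.exp_nat_mul]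
  simp
  ring

/-- The function `D exp(k r) + 1 / r` extends to a smooth function on the line, as `(z - 1) eᶻ + 1`
vanishes at the origin to second order. -/
lemma absolutelyContinuousOnInterval_decayingSolution (k : ℂ) {R : ℝ} (hR : 0 < R) :
    AbsolutelyContinuousOnInterval (decayingSolution k) 0 R := by
  set e : ℂ → ℂ := fun z => (z - 1) * Complex.exp z + 1 with he
  have hed : Differentiable ℂ e := fun z => (hasDerivAt_sub_one_mul_exp_add_one z).differentiableAt
  have hs : Differentiable ℂ (dslope e 0) := by
    rw [← differentiableOn_univ]
    exact (Complex.differentiableOn_dslope univ_mem).2 hed.differentiableOn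
  have hc : ContDiff ℝ 1 fun r : ℝ => k * dslope e 0 (k * r) :=
    contDiff_const.mul ((hs.contDiff.restrict_scalars ℝ).comp
      (contDiff_const.mul Complex.ofRealCLM.contDiff))
  refine (hc.contDiffOn.congr fun r hr => ?_).absolutelyContinuousOnInterval
  rw [uIcc_of_le hR.le] at hr
  rcases hr.1.eq_or_lt with h | h
  · subst h
    simp [decayingSolution, (hasDerivAt_sub_one_mul_exp_add_one 0).deriv, he]
  · rw [decayingSolution_of_pos h]
    have hrc : (r : ℂ) ≠ 0 := by exact_mod_cast h.ne'
    rcases eq_or_ne k 0 with rfl | hk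
    · simp
    · rw [dslope_of_ne _ (mul_ne_zero hk hrc), slope_def_field]
      simp only [he, zero_sub, Complex.exp_zero, mul_one, neg_add_cancel, sub_zero]
      field_simp

lemma isFiniteEnergy_decayingSolution (hk : k.re < 0) : IsFiniteEnergy (decayingSolution k) := by
  have hdiv : MemLp (fun r : ℝ => decayingSolution k r / (r : ℂ)) 2 halfLine := by
    obtain ⟨M, hM⟩ := exists_norm_decayingSolution_div_le hk
    have hmeas : AEStronglyMeasurable (fun r : ℝ => decayingSolution k r / (r : ℂ)) halfLine := by
      refine ContinuousOn.aestronglyMeasurable (fun r hr => ?_) measurableSet_Ioi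
      have hrc : (r : ℂ) ≠ 0 := by exact_mod_cast (ne_of_gt (mem_Ioi.1 hr))
      exact ((hasDerivAt_decayingSolution hr).continuousAt.div
        Complex.continuous_ofReal.continuousAt hrc).continuousWithinAt
    rw [memLp_two_iff_integrable_sq_norm hmeas]
    refine Integrable.mono' ((integrable_inv_one_add_sq.const_mul (M ^ 2)).restrict)
      (hmeas.norm.pow 2) ?_
    filter_upwards [ae_restrict_mem measurableSet_Ioi] with r hr
    have h1 : (1 + r ^ 2)⁻¹ ≤ 1 := inv_le_one_of_one_le₀ (by nlinarith [sq_nonneg r])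
    have h0 : 0 ≤ (1 + r ^ 2)⁻¹ := by positivity
    rw [Real.norm_of_nonneg (by positivity)]
    calc ‖decayingSolution k r / (r : ℂ)‖ ^ 2 ≤ (M * (1 + r ^ 2)⁻¹) ^ 2 := by
          gcongr
          exact hM r hr
      _ = M ^ 2 * ((1 + r ^ 2)⁻¹ * (1 + r ^ 2)⁻¹) := by ring
      _ ≤ M ^ 2 * ((1 + r ^ 2)⁻¹ * 1) := by gcongr
      _ = M ^ 2 * (1 + r ^ 2)⁻¹ := by ring
  refine ⟨fun r hr => if_neg (not_lt.2 hr),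
    fun R hR => absolutelyContinuousOnInterval_decayingSolution k hR, ?_, hdiv⟩
  refine (memLp_congr_ae ?_).2 (((memLp_exp hk).const_mul (k ^ 2)).sub hdiv)
  filter_upwards [ae_restrict_mem measurableSet_Ioi] with r hr
  rw [(hasDerivAt_decayingSolution hr).deriv]
  rfl

lemma adjD_decayingSolution (hk : k.re < 0) :
    EnergySpace.adjD (.mk _ (isFiniteEnergy_decayingSolution hk))
      = k ^ 2 • (memLp_exp hk).toLp _ := by
  refine Lp.ext ?_
  filter_upwards [EnergySpace.coeFn_adjD (.mk _ (isFiniteEnergy_decayingSolution hk)),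
    Lp.coeFn_smul (k ^ 2) ((memLp_exp hk).toLp _), (memLp_exp hk).coeFn_toLp,
    ae_restrict_mem measurableSet_Ioi] with r h1 h2 h3 hr
  rw [h1, h2, Pi.smul_apply, h3, EnergySpace.fn_mk, (hasDerivAt_decayingSolution hr).deriv,
    smul_eq_mul]
  ring

lemma toLp_exp_ne_zero (hk : k.re < 0) : (memLp_exp hk).toLp _ ≠ 0 := by
  intro h
  have h1 : (fun r : ℝ => Complex.exp (k * r)) =ᵐ[halfLine] 0 :=
    (memLp_exp hk).coeFn_toLp.symm.trans ((Lp.eq_zero_iff_ae_eq_zero).1 h)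
  have : (∀ᵐ _ : ℝ ∂halfLine, False) := by
    filter_upwards [h1] with r hr using Complex.exp_ne_zero _ hr
  rw [eventually_false_iff_eq_bot, ae_eq_bot, Measure.restrict_eq_zero] at this
  simp at this

lemma decayingSolution_ne_zero (hk : k.re < 0) :
    EnergySpace.mk _ (isFiniteEnergy_decayingSolution hk) ≠ 0 := by
  intro h
  have h1 := adjD_decayingSolution hk
  rw [h, map_zero, eq_comm, smul_eq_zero] at h1
  rcases h1 with h1 | h1
  · rw [(pow_eq_zero_iff two_ne_zero).1 h1] at hk
    simp at hk
  · exact toLp_exp_ne_zero hk h1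

end DecayingSolution

/-! ### Growth at infinity -/

section Growth

lemma not_memLp_of_eventually_le_norm {f : ℝ → ℂ} {ε : ℝ} (hε : 0 < ε)
    (hf : ∀ᶠ r in atTop, ε ≤ ‖f r‖) : ¬MemLp f 2 halfLine := by
  intro h
  obtain ⟨R, hR⟩ := eventually_atTop.1 hf
  have h1 : MemLp f 2 (volume.restrict (Ioi (max R 0))) :=
    h.mono_measure (Measure.restrict_mono (Ioi_subset_Ioi (le_max_right _ _)) le_rfl)
  have h2 : MemLp (fun _ : ℝ => ε) 2 (volume.restrict (Ioi (max R 0))) := by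
    refine h1.mono aestronglyMeasurable_const ?_
    filter_upwards [ae_restrict_mem measurableSet_Ioi] with r hr
    rw [Real.norm_of_nonneg hε.le]
    exact hR r ((le_max_left _ _).trans (le_of_lt hr))
  rw [memLp_const_iff (by norm_num) (by norm_num)] at h2
  simp [hε.ne'] at h2

lemma eq_zero_of_memLp_mul_id {a : ℂ} (h : MemLp (fun r : ℝ => a * r) 2 halfLine) : a = 0 := by
  by_contra ha
  refine not_memLp_of_eventually_le_norm (norm_pos_iff.2 ha) ?_ h
  filter_upwards [eventually_ge_atTop 1] with r hr
  rw [norm_mul, Complex.norm_real, Real.norm_of_nonneg (by linarith)]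
  exact le_mul_of_one_le_right (norm_nonneg a) hr

lemma eq_zero_of_memLp_growing {a b κ : ℂ} (hκ : κ.re < 0)
    (h : MemLp (fun r : ℝ => a * r + b * Complex.exp (-κ * r)) 2 halfLine) : a = 0 ∧ b = 0 := by
  have hb : b = 0 := by
    by_contra hb
    have hpos : 0 < ‖b‖ := norm_pos_iff.2 hb
    refine not_memLp_of_eventually_le_norm (half_pos hpos) ?_ h
    have h1 : Tendsto (fun r : ℝ => (r : ℂ) * Complex.exp (κ * r)) atTop (𝓝 0) := by
      rw [tendsto_zero_iff_norm_tendsto_zero]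
      have h2 := tendsto_rpow_mul_exp_neg_mul_atTop_nhds_zero 1 (-κ.re) (neg_pos.2 hκ)
      refine h2.congr' ?_
      filter_upwards [eventually_gt_atTop 0] with r hr
      rw [norm_mul, Complex.norm_exp, Complex.norm_real, Real.norm_of_nonneg hr.le, Real.rpow_one]
      simp
    have h2 : Tendsto (fun r : ℝ => a * ((r : ℂ) * Complex.exp (κ * r)) + b) atTop (𝓝 b) := by
      simpa using (h1.const_mul a).add_const b
    filter_upwards [h2.norm.eventually (lt_mem_nhds (half_lt_self hpos)), eventually_ge_atTop 0]
      with r h3 hr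
    have h4 : a * ((r : ℂ) * Complex.exp (κ * r)) + b
        = (a * r + b * Complex.exp (-κ * r)) * Complex.exp (κ * r) := by
      have : Complex.exp (-κ * r) * Complex.exp (κ * r) = 1 := by
        rw [← Complex.exp_add]
        simp
      linear_combination -b * this
    rw [h4, norm_mul] at h3
    refine h3.le.trans (mul_le_of_le_one_right (norm_nonneg _) (norm_exp_le_one ?_))
    simpa using mul_nonpos_of_nonpos_of_nonneg hκ.le hr
  subst hb
  simp only [zero_mul, add_zero] at h
  exact ⟨eq_zero_of_memLp_mul_id h, rfl⟩

end Growth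

/-! ### The domain of the operator -/

section Domain

namespace testFunctions

variable {φ : ℝ → ℂ}

lemma radialT_mem (hφ : φ ∈ testFunctions) : radialT φ ∈ testFunctions := by
  have h := testFunctions.sub_mem (testFunctions.smul_mem 2 (div_mem (div_mem hφ)))
    (deriv_mem (deriv_mem hφ))
  refine (congrArg (· ∈ testFunctions) (funext fun r => ?_)).mp h
  rcases lt_or_ge 0 r with hr | hr
  · rw [radialT, if_pos hr, iteratedDeriv_succ, iteratedDeriv_one]
    simp only [Pi.sub_apply, Pi.smul_apply, smul_eq_mul]
    ring
  · rw [radialT, if_neg (not_lt.2 hr), eq_zero_of_nonpos h hr]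

lemma isFiniteEnergy (hφ : φ ∈ testFunctions) : IsFiniteEnergy φ where
  eq_zero _ hr := eq_zero_of_nonpos hφ hr
  ac _ _ := (hφ.1.of_le (by simp)).contDiffOn.absolutelyContinuousOnInterval
  memLp_deriv := memLp (deriv_mem hφ)
  memLp_div := memLp (div_mem hφ)

lemma mem_domainW0 (hφ : φ ∈ testFunctions) :
    EnergySpace.mk φ (isFiniteEnergy hφ) ∈ domainW0 := by
  refine ⟨hφ.1.contDiffOn, isFiniteEnergy (radialT_mem hφ), ?_⟩
  rw [EnergySpace.fn_mk, iteratedDerivWithin_eq_iteratedDeriv (uniqueDiffOn_Ici 0)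
    (hφ.1.contDiffAt.of_le two_le_smooth) (mem_Ici.2 le_rfl), iteratedDeriv_succ, iteratedDeriv_one]
  exact eq_zero_of_nonpos (deriv_mem (deriv_mem hφ)) le_rfl

end testFunctions

/-- Pairing with `adjD w`, written out for a function whose image under `adjD` is known. -/
lemma inner_eq_integral (w u : EnergySpace) {g : ℝ → ℂ}
    (hg : ∀ r, 0 < r → deriv u.fn r + u.fn r / (r : ℂ) = g r) :
    ⟪w, u⟫_ℂ = ∫ r in Ioi (0 : ℝ), conj (EnergySpace.adjD w r) * g r := by
  rw [← EnergySpace.inner_adjD, L2.inner_def]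
  refine integral_congr_ae ?_
  filter_upwards [EnergySpace.coeFn_adjD u, ae_restrict_mem measurableSet_Ioi] with r h1 h2
  rw [RCLike.inner_apply, h1, hg r h2]
  exact mul_comm _ _

lemma locallyIntegrable_conj_Lp (v : Lp ℂ 2 halfLine) :
    LocallyIntegrable (fun r => conj (v r)) halfLine :=
  (Lp.memLp v).star.locallyIntegrable (by norm_num)

lemma eq_zero_of_conj_ae_eq_zero {v : Lp ℂ 2 halfLine}
    (h : (fun r => conj (v r)) =ᵐ[halfLine] 0) : v = 0 := by
  rw [Lp.eq_zero_iff_ae_eq_zero]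
  filter_upwards [h] with r hr
  exact (map_eq_zero _).1 hr

/-- `D* w` of a vector `w` orthogonal to the domain is orthogonal to all test functions orthogonal
to `r`, hence a multiple of `r`, hence zero. -/
lemma dense_operatorT0_domain : Dense (operatorT0.domain : Set EnergySpace) := by
  rw [Submodule.dense_iff_topologicalClosure_eq_top, Submodule.topologicalClosure_eq_top_iff,
    Submodule.eq_bot_iff]
  intro w hw
  refine EnergySpace.adjD_injective ?_
  rw [map_zero]
  have hid : LocallyIntegrable (fun r : ℝ => (r : ℂ)) halfLine :=
    Complex.continuous_ofReal.locallyIntegrable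
  obtain ⟨c, hc⟩ := testFunctions.exists_ae_eq_sum (ι := Unit) (h := fun _ r => (r : ℂ))
    (fun _ => hid) (locallyIntegrable_conj_Lp (EnergySpace.adjD w)) fun g hg h0 => by
      obtain ⟨φ, hφ, hφg⟩ := testFunctions.exists_deriv_add_div_eq hg (h0 ())
      rw [← inner_eq_integral w (.mk φ (testFunctions.isFiniteEnergy hφ)) hφg]
      exact Submodule.inner_left_of_mem_orthogonal (testFunctions.mem_domainW0 hφ) hw
  simp only [Finset.univ_unique, Finset.sum_singleton] at hc
  have h0 := eq_zero_of_memLp_mul_id ((memLp_congr_ae hc).1 (Lp.memLp (EnergySpace.adjD w)).star)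
  refine eq_zero_of_conj_ae_eq_zero (hc.trans ?_)
  rw [h0]
  filter_upwards with r
  simp

theorem isSymmetricOperator_operatorT0 : IsSymmetricOperator operatorT0 :=
  ⟨dense_operatorT0_domain, isFormalAdjoint_operatorT0⟩

/-- The behaviour of the elements of the domain at the origin. -/
lemma tendsto_zero_of_mem_domainW0 {u : EnergySpace} (hu : u ∈ domainW0) :
    Tendsto (radialT u.fn) (𝓝[>] 0) (𝓝 0) ∧ Tendsto (deriv u.fn) (𝓝[>] 0) (𝓝 0) ∧
    Tendsto (fun r : ℝ => u.fn r / (r : ℂ)) (𝓝[>] 0) (𝓝 0) ∧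
    Tendsto (fun r : ℝ => deriv u.fn r / (r : ℂ)) (𝓝[>] 0) (𝓝 0) ∧
    Tendsto (fun r : ℝ => u.fn r / (r : ℂ) ^ 2) (𝓝[>] 0) (𝓝 0) := by
  obtain ⟨hs, hT, h2⟩ := hu
  have h00 := u.prop.eq_zero 0 le_rfl
  set v := u.fn
  have m0 : (0 : ℝ) ∈ Ici (0 : ℝ) := mem_Ici.2 le_rfl
  have hud := uniqueDiffOn_Ici (0 : ℝ)
  set v₁ := derivWithin v (Ici 0) with hv₁
  set v₂ := derivWithin v₁ (Ici 0) with hv₂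
  have hs₁ : ContDiffOn ℝ ∞ v₁ (Ici 0) := ((contDiffOn_infty_iff_derivWithin hud).1 hs).2
  have hs₂ : ContDiffOn ℝ ∞ v₂ (Ici 0) := ((contDiffOn_infty_iff_derivWithin hud).1 hs₁).2
  have hv₂0 : v₂ 0 = 0 := by
    rw [iteratedDerivWithin_succ] at h2
    rw [← h2, hv₂]
    refine derivWithin_congr (fun x _ => ?_) ?_ <;> rw [iteratedDerivWithin_one]
  have hle : 𝓝[>] (0 : ℝ) ≤ 𝓝[≥] 0 := nhdsWithin_mono _ Ioi_subset_Ici_self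
  have lim₁ : Tendsto v₁ (𝓝[>] 0) (𝓝 (v₁ 0)) := (hs₁.continuousOn 0 m0).mono_left hle
  have lim₂ : Tendsto v₂ (𝓝[>] 0) (𝓝 0) := by
    have := (hs₂.continuousOn 0 m0).mono_left hle
    rwa [hv₂0] at this
  have eq₁ : ∀ r, 0 < r → v₁ r = deriv v r := fun r hr =>
    derivWithin_of_mem_nhds (Ici_mem_nhds hr)
  have eq₂ : ∀ r, 0 < r → v₂ r = 2 / (r : ℂ) ^ 2 * v r - radialT v r := fun r hr => by
    rw [hv₂, derivWithin_of_mem_nhds (Ici_mem_nhds hr), ← (hasDerivAt_deriv_of_smooth hs hr).deriv]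
    refine Filter.EventuallyEq.deriv_eq ?_
    filter_upwards [Ioi_mem_nhds hr] with x hx using eq₁ x hx
  have limT : Tendsto (radialT v) (𝓝[>] 0) (𝓝 0) := by
    have h1 := (hT.ac 1 one_pos).continuousOn 0 left_mem_uIcc
    rw [ContinuousWithinAt, hT.eq_zero 0 le_rfl, uIcc_of_le zero_le_one,
      nhdsWithin_Icc_eq_nhdsGE zero_lt_one] at h1
    exact h1.mono_left hle
  have limdiv2 : Tendsto (fun r : ℝ => v r / (r : ℂ) ^ 2) (𝓝[>] 0) (𝓝 0) := by
    have h1 := (limT.add lim₂).const_mul (1 / 2 : ℂ)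
    simp only [add_zero, mul_zero] at h1
    refine h1.congr' ?_
    filter_upwards [self_mem_nhdsWithin] with r hr
    rw [eq₂ r hr]
    ring
  have limid : Tendsto (fun r : ℝ => (r : ℂ)) (𝓝[>] 0) (𝓝 0) := by
    have := (Complex.continuous_ofReal.tendsto 0).mono_left (nhdsWithin_le_nhds (s := Ioi 0))
    simpa using this
  have limdiv : Tendsto (fun r : ℝ => v r / (r : ℂ)) (𝓝[>] 0) (𝓝 0) := by
    have h1 := limid.mul limdiv2
    rw [mul_zero] at h1
    refine h1.congr' ?_
    filter_upwards [self_mem_nhdsWithin] with r hr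
    have hrc : (r : ℂ) ≠ 0 := by exact_mod_cast (ne_of_gt (mem_Ioi.1 hr))
    field_simp
  -- A one-sided derivative at the origin is the limit of `f r / r` if `f 0 = 0`.
  have hslope : ∀ f : ℝ → ℂ, ContDiffOn ℝ ∞ f (Ici 0) → f 0 = 0 →
      Tendsto (fun r : ℝ => f r / (r : ℂ)) (𝓝[>] 0) (𝓝 (derivWithin f (Ici 0) 0)) := by
    intro f hf hf0
    have h1 := ((hf.differentiableOn (by simp)) 0 m0).hasDerivWithinAt.mono Ioi_subset_Ici_self
    refine ((hasDerivWithinAt_iff_tendsto_slope' (lt_irrefl (0 : ℝ))).1 h1).congr fun r => ?_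
    rw [slope_def_module, hf0, sub_zero, sub_zero, Complex.real_smul, Complex.ofReal_inv,
      inv_mul_eq_div]
  have hv₁0 : v₁ 0 = 0 := tendsto_nhds_unique (hslope v hs h00) limdiv
  have limd : ∀ f : ℝ → ℂ, (∀ r : ℝ, 0 < r → f r = v₁ r) → Tendsto f (𝓝[>] 0) (𝓝 0) := by
    intro f hf
    rw [← hv₁0]
    refine lim₁.congr' ?_
    filter_upwards [self_mem_nhdsWithin] with r hr using (hf r hr).symm
  have limdd := hslope v₁ hs₁ hv₁0
  rw [← hv₂, hv₂0] at limdd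
  refine ⟨limT, limd _ fun r hr => (eq₁ r hr).symm, limdiv, limdd.congr' ?_, limdiv2⟩
  filter_upwards [self_mem_nhdsWithin] with r hr
  rw [eq₁ r hr]

/-- For `η = u' + u / r` one has `η' = η / r - T u`. -/
lemma hasDerivAt_deriv_add_div {u : ℝ → ℂ} (hu : ContDiffOn ℝ ∞ u (Ici 0)) {r : ℝ} (hr : 0 < r) :
    HasDerivAt (fun r : ℝ => deriv u r + u r / (r : ℂ))
      ((deriv u r + u r / (r : ℂ)) / (r : ℂ) - radialT u r) r := by
  have hrc : (r : ℂ) ≠ 0 := by exact_mod_cast hr.ne'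
  have hid : HasDerivAt (fun r : ℝ => (r : ℂ)) 1 r := (hasDerivAt_id (r : ℂ)).comp_ofReal
  refine ((hasDerivAt_deriv_of_smooth hu hr).add
    ((hasDerivAt_of_smooth hu hr).div hid hrc)).congr_deriv ?_
  field_simp
  ring

/-- For `η = u' + u / r` one has `η'' = -((T u)' + (T u) / r)`: the intertwining relation
`D* T = -(d²/dr²) D*`. -/
lemma hasDerivAt_deriv_deriv_add_div {u : ℝ → ℂ} (hu : ContDiffOn ℝ ∞ u (Ici 0)) {r : ℝ}
    (hr : 0 < r) :
    HasDerivAt (fun r : ℝ => (deriv u r + u r / (r : ℂ)) / (r : ℂ) - radialT u r)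
      (-(deriv (radialT u) r + radialT u r / (r : ℂ))) r := by
  have hrc : (r : ℂ) ≠ 0 := by exact_mod_cast hr.ne'
  have hid : HasDerivAt (fun r : ℝ => (r : ℂ)) 1 r := (hasDerivAt_id (r : ℂ)).comp_ofReal
  refine (((hasDerivAt_deriv_add_div hu hr).div hid hrc).sub
    (hasDerivAt_radialT_of_smooth hu hr)).congr_deriv ?_
  field_simp
  ring

end Domain

/-! ### The deficiency spaces -/

section DeficiencySpaces

/-- Integration by parts twice against the exponential. With `η = u' + u / r`, the boundary term
`e^{κ r} (η' - κ η)` vanishes at the origin thanks to the condition `u''(0) = 0`. -/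
lemma integral_exp_mul_eq_zero {κ : ℂ} (hκ : κ.re < 0) {u : EnergySpace} (hu : u ∈ domainW0) :
    ∫ r in Ioi (0 : ℝ), Complex.exp (κ * r) *
      ((deriv (radialT u.fn) r + radialT u.fn r / (r : ℂ))
        + κ ^ 2 * (deriv u.fn r + u.fn r / (r : ℂ))) = 0 := by
  obtain ⟨limT, lim1, lim2, lim3, lim4⟩ := tendsto_zero_of_mem_domainW0 hu
  obtain ⟨hs, hT, -⟩ := hu
  have hE := u.prop
  set v := u.fn
  have hη : MemLp (fun r : ℝ => deriv v r + v r / (r : ℂ)) 2 halfLine :=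
    hE.memLp_deriv.add hE.memLp_div
  have hηT : MemLp (fun r : ℝ => deriv (radialT v) r + radialT v r / (r : ℂ)) 2 halfLine :=
    hT.memLp_deriv.add hT.memLp_div
  have hexp := memLp_exp hκ
  set F : ℝ → ℂ := fun r => -(Complex.exp (κ * r) *
    (((deriv v r + v r / (r : ℂ)) / (r : ℂ) - radialT v r)
      - κ * (deriv v r + v r / (r : ℂ)))) with hF
  have hd : ∀ r : ℝ, 0 < r → HasDerivAt F (Complex.exp (κ * r) *
      ((deriv (radialT v) r + radialT v r / (r : ℂ))
        + κ ^ 2 * (deriv v r + v r / (r : ℂ)))) r := fun r hr => by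
    refine ((testFunctions.hasDerivAt_cexp κ r).mul ((hasDerivAt_deriv_deriv_add_div hs hr).sub
      ((hasDerivAt_deriv_add_div hs hr).const_mul κ))).neg.congr_deriv ?_
    simp only [Pi.sub_apply]
    ring
  have hprim : IsHalfLinePrimitive F _ :=
    .of_hasDerivAt (hexp.integrable_mul (hηT.add (hη.const_mul (κ ^ 2)))) hd
  have h0 : Tendsto F (𝓝[>] 0) (𝓝 0) := by
    have hcont : Tendsto (fun r : ℝ => Complex.exp (κ * r)) (𝓝[>] 0) (𝓝 (Complex.exp (κ * 0))) := by
      have := ((testFunctions.contDiff_cexp κ).continuous.tendsto 0).mono_left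
        (nhdsWithin_le_nhds (s := Ioi 0))
      simpa using this
    have h1 := (hcont.mul (((lim3.add lim4).sub limT).sub ((lim1.add lim2).const_mul κ))).neg
    simp only [add_zero, sub_zero, mul_zero, neg_zero] at h1
    refine h1.congr fun r => ?_
    simp only [hF]
    ring
  have hinf : Tendsto F atTop (𝓝 0) := by
    refine hprim.tendsto_atTop_zero ?_
    have hbound : Integrable (fun r : ℝ => (1 + ‖κ‖) *
        ‖Complex.exp (κ * r) * (deriv v r + v r / (r : ℂ))‖
        + ‖Complex.exp (κ * r) * (radialT v r / (r : ℂ))‖) (volume.restrict (Ioi 1)) := by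
      have h1 := (hexp.integrable_mul hη).norm.const_mul (1 + ‖κ‖)
      have h2 := (hexp.integrable_mul hT.memLp_div).norm
      exact (h1.add h2).mono_measure
        (Measure.restrict_mono (Ioi_subset_Ioi zero_le_one) le_rfl)
    refine hbound.mono' ?_ ?_
    · refine ContinuousOn.aestronglyMeasurable (fun r hr => ?_) measurableSet_Ioi
      have hr0 : 0 < r := one_pos.trans hr
      have hrc : (r : ℂ) ≠ 0 := by exact_mod_cast hr0.ne'
      exact ((hd r hr0).continuousAt.div
        Complex.continuous_ofReal.continuousAt hrc).continuousWithinAt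
    · filter_upwards [ae_restrict_mem measurableSet_Ioi] with r hr
      have hr0 : 0 < r := one_pos.trans hr
      have hrc : (r : ℂ) ≠ 0 := by exact_mod_cast hr0.ne'
      set η := deriv v r + v r / (r : ℂ) with hη'
      have hinv : ‖(r : ℂ)⁻¹‖ ≤ 1 := by
        rw [norm_inv, Complex.norm_real, Real.norm_of_nonneg hr0.le]
        exact inv_le_one_of_one_le₀ (le_of_lt hr)
      have e1 : F r / (r : ℂ) = Complex.exp (κ * r) * (radialT v r / (r : ℂ))
          - ((r : ℂ)⁻¹ * (r : ℂ)⁻¹ - κ * (r : ℂ)⁻¹) * (Complex.exp (κ * r) * η) := by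
        simp only [hF, ← hη']
        field_simp
        ring
      have e2 : ‖(r : ℂ)⁻¹ * (r : ℂ)⁻¹ - κ * (r : ℂ)⁻¹‖ ≤ 1 + ‖κ‖ := by
        refine (norm_sub_le _ _).trans (add_le_add ?_ ?_)
        · rw [norm_mul]
          exact mul_le_one₀ hinv (norm_nonneg _) hinv
        · rw [norm_mul]
          exact mul_le_of_le_one_right (norm_nonneg _) hinv
      rw [e1, add_comm]
      refine (norm_sub_le _ _).trans (add_le_add le_rfl ?_)
      rw [norm_mul ((r : ℂ)⁻¹ * (r : ℂ)⁻¹ - κ * (r : ℂ)⁻¹)]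
      gcongr
  exact (hprim.integral_eq_sub h0 hinf).trans (sub_zero 0)

variable {k : ℂ}

lemma decayingSolution_mem_deficiencySpace (hk : k.re < 0) :
    EnergySpace.mk _ (isFiniteEnergy_decayingSolution hk) ∈
      deficiencySpace operatorT0 (-k ^ 2) := by
  rw [mem_deficiencySpace_iff dense_operatorT0_domain]
  intro u
  have hκ : (conj k).re < 0 := by simpa using hk
  have h0 := integral_exp_mul_eq_zero hκ u.2
  have hT : IsFiniteEnergy (radialT (u : EnergySpace).fn) := u.2.2.1
  have hE := (u : EnergySpace).prop
  have key : ∀ w : EnergySpace,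
      ⟪EnergySpace.mk _ (isFiniteEnergy_decayingSolution hk), w⟫_ℂ = (conj k) ^ 2 *
        ∫ r in Ioi (0 : ℝ), Complex.exp (conj k * r) * (deriv w.fn r + w.fn r / (r : ℂ)) := by
    intro w
    rw [← EnergySpace.inner_adjD, adjD_decayingSolution hk, inner_smul_left, map_pow, L2.inner_def]
    congr 1
    refine integral_congr_ae ?_
    filter_upwards [EnergySpace.coeFn_adjD w, (memLp_exp hk).coeFn_toLp] with r h1 h2
    rw [RCLike.inner_apply, h1, h2, ← Complex.exp_conj, map_mul, Complex.conj_ofReal]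
    exact mul_comm _ _
  rw [key, key, operatorT0_fn]
  have i1 : Integrable (fun r : ℝ => Complex.exp (conj k * r) *
      (deriv (radialT (u : EnergySpace).fn) r + radialT (u : EnergySpace).fn r / (r : ℂ)))
      halfLine := (memLp_exp hκ).integrable_mul (hT.memLp_deriv.add hT.memLp_div)
  have i2 : Integrable (fun r : ℝ => Complex.exp (conj k * r) *
      (deriv (u : EnergySpace).fn r + (u : EnergySpace).fn r / (r : ℂ))) halfLine :=
    (memLp_exp hκ).integrable_mul (hE.memLp_deriv.add hE.memLp_div)
  simp only [mul_add (Complex.exp _) (_ + _) (_ * _), mul_left_comm _ ((conj k) ^ 2) _] at h0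
  rw [integral_add i1 (i2.const_mul _), integral_const_mul] at h0
  rw [map_neg, map_pow]
  linear_combination (conj k) ^ 2 * h0

/-- For `w` in the deficiency space, `D* w` is a weak solution of `-v'' + k² v = c r`, and
`e^{k r}` spans the square-integrable ones. -/
theorem deficiencySpace_eq_span (hk : k.re < 0) :
    deficiencySpace operatorT0 (-k ^ 2)
      = Submodule.span ℂ {EnergySpace.mk _ (isFiniteEnergy_decayingSolution hk)} := by
  refine le_antisymm (fun w hw => ?_)
    ((Submodule.span_singleton_le_iff_mem _ _).2 (decayingSolution_mem_deficiencySpace hk))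
  rw [mem_deficiencySpace_iff dense_operatorT0_domain] at hw
  have hk0 : k ≠ 0 := by
    rintro rfl
    simp at hk
  set κ := conj k with hκd
  have hκ : κ.re < 0 := by simpa [hκd] using hk
  have hκ0 : κ ≠ 0 := (map_ne_zero _).2 hk0
  have hloc : ∀ i : Fin 3, LocallyIntegrable ((![fun r : ℝ => (r : ℂ),
      fun r : ℝ => Complex.exp (κ * r), fun r : ℝ => Complex.exp (-κ * r)] :
        Fin 3 → ℝ → ℂ) i) halfLine := by
    intro i
    fin_cases i
    · exact Complex.continuous_ofReal.locallyIntegrable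
    · exact (testFunctions.contDiff_cexp κ).continuous.locallyIntegrable
    · exact (testFunctions.contDiff_cexp (-κ)).continuous.locallyIntegrable
  obtain ⟨c, hc⟩ := testFunctions.exists_ae_eq_sum hloc
    (locallyIntegrable_conj_Lp (EnergySpace.adjD w))
    fun g hg h0 => by
      obtain ⟨φ, hφ, η', hd, hd'⟩ :=
        testFunctions.exists_solution hκ0 hg (h0 0) (h0 1) (h0 2)
      set u : operatorT0.domain := ⟨_, testFunctions.mem_domainW0 hφ⟩ with hu
      have hus : ContDiffOn ℝ ∞ φ (Ici 0) := hφ.1.contDiffOn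
      have hη' : ∀ r : ℝ, 0 < r →
          η' r = (deriv φ r + φ r / (r : ℂ)) / (r : ℂ) - radialT φ r := fun r hr =>
        (hd r hr).unique (hasDerivAt_deriv_add_div hus hr)
      have hg' : ∀ r : ℝ, 0 < r → deriv (radialT φ) r + radialT φ r / (r : ℂ)
          = g r - κ ^ 2 * (deriv φ r + φ r / (r : ℂ)) := fun r hr => by
        have h1 := (hd' r hr).unique (f := η')
          ((hasDerivAt_deriv_deriv_add_div hus hr).congr_of_eventuallyEq (by
            filter_upwards [Ioi_mem_nhds hr] with x hx using hη' x hx))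
        linear_combination h1
      have h1 := hw u
      rw [inner_eq_integral w (operatorT0 u) hg', inner_eq_integral w u
        (g := fun r => deriv φ r + φ r / (r : ℂ)) fun _ _ => rfl] at h1
      have i1 := testFunctions.integrable_mul hg (locallyIntegrable_conj_Lp (EnergySpace.adjD w))
      have i2 : Integrable (fun r => conj (EnergySpace.adjD w r) * (deriv φ r + φ r / (r : ℂ)))
          halfLine := testFunctions.integrable_mul
        (testFunctions.add_mem (testFunctions.deriv_mem hφ) (testFunctions.div_mem hφ))
        (locallyIntegrable_conj_Lp (EnergySpace.adjD w))
      simp only [mul_sub, mul_left_comm _ (κ ^ 2) _] at h1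
      rw [integral_sub i1 (i2.const_mul _), integral_const_mul, map_neg, map_pow] at h1
      linear_combination h1
  simp only [Fin.sum_univ_three, Matrix.cons_val_zero, Matrix.cons_val_one, Matrix.cons_val] at hc
  -- The growing components have to vanish.
  have hgrow : MemLp (fun r : ℝ => c 0 * r + c 2 * Complex.exp (-κ * r)) 2 halfLine := by
    have h1 := (memLp_congr_ae hc).1 (Lp.memLp (EnergySpace.adjD w)).star
    refine (memLp_congr_ae (Eventually.of_forall fun r => ?_)).1
      (h1.sub ((memLp_exp hκ).const_mul (c 1)))
    simp only [Pi.sub_apply]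
    ring
  obtain ⟨hc0, hc2⟩ := eq_zero_of_memLp_growing hκ hgrow
  rw [Submodule.mem_span_singleton]
  refine ⟨conj (c 1) / k ^ 2, EnergySpace.adjD_injective ?_⟩
  rw [map_smul, adjD_decayingSolution hk, smul_smul, div_mul_cancel₀ _ (pow_ne_zero 2 hk0)]
  refine Lp.ext ?_
  filter_upwards [hc, Lp.coeFn_smul (conj (c 1)) ((memLp_exp hk).toLp _),
    (memLp_exp hk).coeFn_toLp] with r h1 h2 h3
  rw [h2, Pi.smul_apply, h3, smul_eq_mul]
  have h4 := congrArg conj h1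
  rw [Complex.conj_conj] at h4
  rw [h4, hc0, hc2]
  simp [← Complex.exp_conj, hκd]

end DeficiencySpaces

/-! ### The exponents `e^{∓3πi/4} ρ` -/

section Exponents

lemma exp_three_pi_div_four_sq : Complex.exp (3 * (Real.pi : ℂ) * Complex.I / 4) ^ 2
    = -Complex.I := by
  rw [← Complex.exp_nat_mul, show ((2 : ℕ) : ℂ) * (3 * (Real.pi : ℂ) * Complex.I / 4)
    = Real.pi * Complex.I + Real.pi / 2 * Complex.I by push_cast; ring, Complex.exp_add,
    Complex.exp_pi_mul_I, Complex.exp_pi_div_two_mul_I]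
  ring

lemma exp_three_pi_div_four_re_neg :
    (Complex.exp (3 * (Real.pi : ℂ) * Complex.I / 4)).re < 0 := by
  have h : 3 * (Real.pi : ℂ) * Complex.I / 4 = ((3 * Real.pi / 4 : ℝ) : ℂ) * Complex.I := by
    push_cast
    ring
  rw [h, Complex.exp_ofReal_mul_I_re]
  have := Real.pi_pos
  exact Real.cos_neg_of_pi_div_two_lt_of_lt (by linarith) (by linarith)

lemma exp_neg_three_pi_div_four :
    Complex.exp (-(3 * (Real.pi : ℂ) * Complex.I / 4))
      = conj (Complex.exp (3 * (Real.pi : ℂ) * Complex.I / 4)) := by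
  rw [← Complex.exp_conj]
  congr 1
  simp only [map_div₀, map_mul, Complex.conj_ofNat, Complex.conj_ofReal, Complex.conj_I]
  ring

/-- The function `D exp(k r) + 1 / r` as an eigenvector of the adjoint. -/
lemma exists_span_eq_deficiencySpace {k z : ℂ} (hk : k.re < 0) (hz : z = -k ^ 2) :
    ∃ c : EnergySpace, (∀ r : ℝ, 0 < r →
        c.fn r = radialD (fun s : ℝ => Complex.exp (k * (s : ℂ))) r + 1 / (r : ℂ)) ∧
      c ≠ 0 ∧ deficiencySpace operatorT0 z = Submodule.span ℂ {c} := by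
  refine ⟨.mk _ (isFiniteEnergy_decayingSolution hk), fun r hr => ?_,
    decayingSolution_ne_zero hk, hz ▸ deficiencySpace_eq_span hk⟩
  have hrc : (r : ℂ) ≠ 0 := by exact_mod_cast hr.ne'
  rw [EnergySpace.fn_mk, decayingSolution_of_pos hr, radialD,
    (testFunctions.hasDerivAt_cexp k r).deriv]
  field_simp

end Exponents

theorem mainTheorem1 :
    IsSymmetricOperator operatorT0 ∧
    deficiencyIndices operatorT0 = (1, 1) ∧
    (∀ ρ : ℝ, 0 < ρ → ∃ cPlus cMinus : EnergySpace,
      (∀ r : ℝ, 0 < r → cPlus.fn r =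
        radialD (fun s : ℝ =>
          Complex.exp (Complex.exp (-(3 * (Real.pi : ℂ) * Complex.I / 4)) * (ρ : ℂ) * (s : ℂ))) r
          + 1 / (r : ℂ)) ∧
      (∀ r : ℝ, 0 < r → cMinus.fn r =
        radialD (fun s : ℝ =>
          Complex.exp (Complex.exp (3 * (Real.pi : ℂ) * Complex.I / 4) * (ρ : ℂ) * (s : ℂ))) r
          + 1 / (r : ℂ)) ∧
      cPlus ≠ 0 ∧ cMinus ≠ 0 ∧
      deficiencySpace operatorT0 (-(Complex.I * (ρ : ℂ) ^ 2)) = Submodule.span ℂ {cPlus} ∧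
      deficiencySpace operatorT0 (Complex.I * (ρ : ℂ) ^ 2) = Submodule.span ℂ {cMinus}) ∧
    (∃ A B : EnergySpace →ₗ.[ℂ] EnergySpace, A ≠ B ∧ operatorT0 ≤ A ∧ operatorT0 ≤ B ∧
      IsSelfAdjoint A ∧ IsSelfAdjoint B) := by
  have hplus : ∀ ρ : ℝ, 0 < ρ → _ := fun ρ hρ =>
    exists_span_eq_deficiencySpace
      (k := Complex.exp (-(3 * (Real.pi : ℂ) * Complex.I / 4)) * (ρ : ℂ))
      (z := -(Complex.I * (ρ : ℂ) ^ 2))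
      (by
        rw [exp_neg_three_pi_div_four, Complex.re_mul_ofReal, Complex.conj_re]
        exact mul_neg_of_neg_of_pos exp_three_pi_div_four_re_neg hρ)
      (by
        rw [exp_neg_three_pi_div_four, mul_pow, ← map_pow, exp_three_pi_div_four_sq, map_neg,
          Complex.conj_I, neg_neg])
  have hminus : ∀ ρ : ℝ, 0 < ρ → _ := fun ρ hρ =>
    exists_span_eq_deficiencySpace
      (k := Complex.exp (3 * (Real.pi : ℂ) * Complex.I / 4) * (ρ : ℂ))
      (z := Complex.I * (ρ : ℂ) ^ 2)
      (by
        rw [Complex.re_mul_ofReal]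
        exact mul_neg_of_neg_of_pos exp_three_pi_div_four_re_neg hρ)
      (by
        rw [mul_pow, exp_three_pi_div_four_sq]
        ring)
  obtain ⟨p, -, hp0, hp⟩ := hminus 1 one_pos
  obtain ⟨n, -, hn0, hn⟩ := hplus 1 one_pos
  rw [Complex.ofReal_one, one_pow, mul_one] at hp hn
  refine ⟨isSymmetricOperator_operatorT0, ?_, fun ρ hρ => ?_,
    exists_two_selfAdjoint_extensions isSymmetricOperator_operatorT0 hp0 hn0 hp hn⟩
  · rw [deficiencyIndices, hp, hn,
      Module.rank_eq_one_iff_finrank_eq_one.2 (finrank_span_singleton hp0),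
      Module.rank_eq_one_iff_finrank_eq_one.2 (finrank_span_singleton hn0)]
  · obtain ⟨cPlus, h1, h2, h3⟩ := hplus ρ hρ
    obtain ⟨cMinus, h4, h5, h6⟩ := hminus ρ hρ
    exact ⟨cPlus, cMinus, h1, h4, h2, h5, h3, h6⟩
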